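/- Let $A\in\mathbb C^{m\times n}$ and let $B\in\mathbb C^{m\times m}$ be Hermitian. For a complex matrix $C$ write $C^*$ for its conjugate transpose, $r(C)$ for its rank and $\mathscr R(C)$ for its column space; for a Hermitian matrix $H$ let $i_+(H)$ and $i_-(H)$ be the numbers of positive and of negative eigenvalues of $H$, counted with multiplicity. For Hermitian $X,Y$ write $X\succ Y$ (resp. $X\succcurlyeq Y$) if $X-Y$ is positive definite (resp. positive semidefinite), and $X\prec Y$, $X\preccurlyeq Y$ for $Y\succ X$, $Y\succcurlyeq X$. Let $$\mathcal S=\{X=X^*\in\mathbb C^{n\times n} : \|B-AXA^*\|_F=\min_{Z=Z^*}\|B-AZA^*\|_F\},\qquad \mathcal T=\{Y=Y^*\in\mathbb C^{n\times n} : r(B-AYA^*)=\min_{Z=Z^*} r(B-AZA^*)\}$$ be the sets of Hermitian least-squares solutions and of Hermitian least-rank solutions of $AXA^*=B$, where $\|\cdot\|_F$ is the Frobenius norm, and let $$M=\begin{bmatrix}B&A\\A^*&0\end{bmatrix},\qquad N=\begin{bmatrix}B&BA&A\\A^*B&0&0\\A^*&0&0\end{bmatrix}.$$ Then the following extrema over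 $X\in\mathcal S$, $Y\in\mathcal T$ are attained and have the stated values (upper signs and lower signs being read together): $$\max r(X-Y)=\min\{n,\ 2n+r(N)-2r(A)-r(M)\},\qquad \min r(X-Y)=r(N)+r(M)-2r[A,B]-2r(A),$$ $$\max i_\pm(X-Y)=i_\mp(N)+n-r(A)-i_\mp(M),\qquad \min i_\pm(X-Y)=i_\mp(N)+i_\pm(M)-r[A,B]-r(A).$$ Moreover: (a) There exist $X\in\mathcal S$, $Y\in\mathcal T$ with $X-Y$ nonsingular iff $r(N)\ge 2r(A)+r(M)-n$. (b) $X-Y$ is nonsingular for all $X\in\mathcal S$, $Y\in\mathcal T$ iff $r(N)+r(M)=2r[A,B]+2r(A)+n$. (c) There exist $X\in\mathcal S$, $Y\in\mathcal T$ with $X=Y$ iff $r(N)+r(M)=2r[A,B]+2r(A)$. (d) There exist $X\in\mathcal S$, $Y\in\mathcal T$ with $X\succ Y$ iff $i_-(N)=i_-(M)+r(A)$. (e) $X\succ Y$ for all $X\in\mathcal S$, $Y\in\mathcal T$ iff $i_-(N)=r(A)+r[A,B]-i_+(M)+n$. (f) There exist $X\in\mathcal S$, $Y\in\mathcal T$ with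 $X\succcurlyeq Y$ iff $i_+(N)=r(A)+r[A,B]-i_-(M)$. (g) $X\succcurlyeq Y$ for all $X\in\mathcal S$, $Y\in\mathcal T$ iff $i_+(N)=i_+(M)+r(A)-n$. (h) There exist $X\in\mathcal S$, $Y\in\mathcal T$ with $X\prec Y$ iff $i_+(N)=i_+(M)+r(A)$. (i) $X\prec Y$ for all $X\in\mathcal S$, $Y\in\mathcal T$ iff $i_+(N)=r(A)+r[A,B]-i_-(M)+n$. (j) There exist $X\in\mathcal S$, $Y\in\mathcal T$ with $X\preccurlyeq Y$ iff $i_-(N)=r(A)+r[A,B]-i_+(M)$. (k) $X\preccurlyeq Y$ for all $X\in\mathcal S$, $Y\in\mathcal T$ iff $i_-(N)=i_-(M)+r(A)-n$. If in addition $B\succcurlyeq 0$, then (extrema again over $X\in\mathcal S$, $Y\in\mathcal T$, and attained) $$\max r(X-Y)=\min\{n,\ 2n+r[A,BA]-3r(A)\},\qquad \min r(X-Y)=r[A,BA]-r(A),$$ $$\max i_+(X-Y)=r[A,BA]+n-2r(A),\qquad \max i_-(X-Y)=n-r(A),$$ $$\min i_+(X-Y)=r[A,BA]-r(A),\qquad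 \min i_-(X-Y)=0,$$ and the following hold: (l) There exist $X\in\mathcal S$, $Y\in\mathcal T$ with $X-Y$ nonsingular iff $r[A,BA]\ge 3r(A)-n$. (m) $X-Y$ is nonsingular for all $X\in\mathcal S$, $Y\in\mathcal T$ iff $r[A,BA]=r(A)+n$. (n) There exist $X\in\mathcal S$, $Y\in\mathcal T$ with $X=Y$ iff $\mathscr R(BA)\subseteq\mathscr R(A)$. (o) There exist $X\in\mathcal S$, $Y\in\mathcal T$ with $X\succ Y$ iff $r[A,BA]=2r(A)$. (p) $X\succ Y$ for all $X\in\mathcal S$, $Y\in\mathcal T$ iff $r[A,BA]=r(A)+n$. (q) There always exist $X\in\mathcal S$, $Y\in\mathcal T$ with $X\succcurlyeq Y$. (r) $X\succcurlyeq Y$ for all $X\in\mathcal S$, $Y\in\mathcal T$ iff $r(A)=n$. (s) There exist $X\in\mathcal S$, $Y\in\mathcal T$ with $X\prec Y$ iff $A=0$. (t) There exist $X\in\mathcal S$, $Y\in\mathcal T$ with $X\preccurlyeq Y$ iff $\mathscr R(BA)\subseteq\mathscr R(A)$. (u) $X\preccurlyeq Y$ for all $X\in\mathcal S$, $Y\in\mathcal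 T$ iff $r[A,BA]=2r(A)-n$. -/

import Mathlib

open scoped Matrix ComplexOrder

noncomputable section

namespace HermSol

section Frobenius

open scoped Matrix.Norms.Frobenius

/-- The Frobenius norm of a complex matrix. -/
def frobNorm {m n : ℕ} (C : Matrix (Fin m) (Fin n) ℂ) : ℝ := ‖C‖

end Frobenius

/-- Hermitian least-squares solutions of `A X Aᴴ = B`: the Hermitian minimizers of
`‖B - A X Aᴴ‖` (Frobenius norm) over all Hermitian matrices. -/
def leastSquares {m n : ℕ} (A : Matrix (Fin m) (Fin n) ℂ) (B : Matrix (Fin m) (Fin m) ℂ) :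
    Set (Matrix (Fin n) (Fin n) ℂ) :=
  {X | X.IsHermitian ∧ ∀ Z : Matrix (Fin n) (Fin n) ℂ, Z.IsHermitian →
    frobNorm (B - A * X * Aᴴ) ≤ frobNorm (B - A * Z * Aᴴ)}

/-- Hermitian least-rank solutions of `A Y Aᴴ = B`: the Hermitian minimizers of
the rank of `B - A Y Aᴴ` over all Hermitian matrices. -/
def leastRank {m n : ℕ} (A : Matrix (Fin m) (Fin n) ℂ) (B : Matrix (Fin m) (Fin m) ℂ) :
    Set (Matrix (Fin n) (Fin n) ℂ) :=
  {Y | Y.IsHermitian ∧ ∀ Z : Matrix (Fin n) (Fin n) ℂ, Z.IsHermitian →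
    (B - A * Y * Aᴴ).rank ≤ (B - A * Z * Aᴴ).rank}

/-- The rank, as an integer, so that differences of ranks do not truncate. -/
def rk {k l : Type} [Fintype k] [Fintype l] (C : Matrix k l ℂ) : ℤ := C.rank

open Classical in
/-- The number of positive eigenvalues, counted with multiplicity as roots of the characteristic
polynomial. (`0 < z` for complex `z` means that `z` is real and positive.) -/
def iPos {k : Type} [Fintype k] [DecidableEq k] (C : Matrix k k ℂ) : ℤ :=
  (C.charpoly.roots.filter fun z => 0 < z).card

open Classical in
/-- The number of negative eigenvalues, counted with multiplicity as roots of the characteristic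
polynomial. (`z < 0` for complex `z` means that `z` is real and negative.) -/
def iNeg {k : Type} [Fintype k] [DecidableEq k] (C : Matrix k k ℂ) : ℤ :=
  (C.charpoly.roots.filter fun z => z < 0).card

/-- The block matrix `[[B, A], [Aᴴ, 0]]`. -/
def blockM {m n : ℕ} (A : Matrix (Fin m) (Fin n) ℂ) (B : Matrix (Fin m) (Fin m) ℂ) :
    Matrix (Fin m ⊕ Fin n) (Fin m ⊕ Fin n) ℂ :=
  Matrix.fromBlocks B A Aᴴ 0

/-- The block matrix `[[B, B A, A], [Aᴴ B, 0, 0], [Aᴴ, 0, 0]]`. -/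
def blockN {m n : ℕ} (A : Matrix (Fin m) (Fin n) ℂ) (B : Matrix (Fin m) (Fin m) ℂ) :
    Matrix (Fin m ⊕ (Fin n ⊕ Fin n)) (Fin m ⊕ (Fin n ⊕ Fin n)) ℂ :=
  Matrix.fromBlocks B (Matrix.fromCols (B * A) A) (Matrix.fromRows (Aᴴ * B) Aᴴ) 0

/-- The set of values `f (X - Y)`, with `X` a Hermitian least-squares solution and `Y` a Hermitian
least-rank solution of `A X Aᴴ = B`. -/
def values {m n : ℕ} (A : Matrix (Fin m) (Fin n) ℂ) (B : Matrix (Fin m) (Fin m) ℂ)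
    (f : Matrix (Fin n) (Fin n) ℂ → ℤ) : Set ℤ :=
  {v | ∃ X ∈ leastSquares A B, ∃ Y ∈ leastRank A B, v = f (X - Y)}

/-- The column space of a matrix. -/
def colSpace {k l : ℕ} (C : Matrix (Fin k) (Fin l) ℂ) : Submodule ℂ (Fin k → ℂ) :=
  LinearMap.range C.mulVecLin

end HermSol

end

open HermSol

/-!
The Hermitian least-squares solutions `X` and the Hermitian least-rank solutions `Y` of `A X Aᴴ = B`
are both cut out by affine conditions, and the differences `X - Y` turn out to be *all* Hermitian
matrices `Δ` whose compression `T Δ Tᴴ` to a certain subspace is a fixed Hermitian matrix `G`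
(`exists_compression`). All extrema are then those of the rank and inertia of a Hermitian
matrix with a prescribed principal block.

*Reduction.* Factor `A = Q R` with `[Q F]` unitary and `R` right invertible. By Pythagoras
(`RankFactorization.trace_residual`), `X` is a least-squares solution iff `R X Rᴴ = Qᴴ B Q`. In the
basis `[Q F]` the residual `B - A Y Aᴴ` is the block matrix `[[K, C], [Cᴴ, E]]` with `K` an arbitrary
Hermitian matrix, `C = Qᴴ B F` and `E = Fᴴ B F`. A Schur complement with respect to the pseudo-inverse
`E⁺` (`PseudoInverse.inertia_fromBlocks`) gives
`i±[[K, C], [Cᴴ, E]] = i±(E) + c + i±(F'ᴴ (K - C E⁺ Cᴴ) F')`, where `c` is the rank of `C` restricted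
to `ker E` and the columns of `F'` span the orthogonal complement of the range of that restriction. So
`Y` has least rank iff the last term vanishes, and the constraint on `X - Y` is
`T (X - Y) Tᴴ = G` with `T = F'ᴴ R` and `G = F'ᴴ C E⁺ Cᴴ F'`.

*Invariants.* With `a = r(A)` and `g = a - c` the size of `G`, the same formulas give
`i±(M) = a + i±(E)`, `i±(N) = a + i±(E) + c + i∓(G)` and `r[A, B] = a + r(E) + c`.
If `B` is positive semidefinite then `i₋(E) = c = i₋(G) = 0` and `i₋(N) = r[A, BA]`.

*Extrema.* A Hermitian matrix of size `n` with principal block `G` of size `n - f` satisfies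
`i±(G) ≤ i± ≤ i±(G) + f`. These bounds are attained by block diagonal matrices, and the rank
`min (n, r(G) + 2 f)` by a bordering that couples `ker G` to the new coordinates
(`exists_bordering_rk`). Substituting the invariants gives the stated values (`exists_extrema`), and
each of the equivalences says that an extreme value is the trivial bound `0` or `n`.

All inertia formulas rest on the inequality `i±(Pᴴ H P) ≤ i±(H)` for rectangular `P`
(`iPos_conjTranspose_mul_mul_le`), which contains Sylvester's law of inertia.
-/

namespace HermSol

open Matrix

set_option linter.unusedSectionVars false

/-! ### Inertia of Hermitian matrices -/

section

variable {k l p q : Type} [Fintype k] [DecidableEq k] [Fintype l] [DecidableEq l]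
  [Fintype p] [DecidableEq p] [Fintype q] [DecidableEq q]

/-- The spectral theorem, in a form without the unitary group. -/
theorem exists_spectral {H : Matrix k k ℂ} (hH : H.IsHermitian) :
    ∃ (V : Matrix k k ℂ) (μ : k → ℝ), Vᴴ * V = 1 ∧ V * Vᴴ = 1 ∧
      H = V * diagonal (fun i => (μ i : ℂ)) * Vᴴ :=
  ⟨hH.eigenvectorUnitary, hH.eigenvalues, Unitary.coe_star_mul_self _,
    Unitary.coe_mul_star_self _, hH.spectral_theorem⟩

theorem roots_charpoly_conj_diagonal {V : Matrix k k ℂ} (hV : Vᴴ * V = 1) (d : k → ℂ) :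
    (V * diagonal d * Vᴴ).charpoly.roots = Multiset.map d Finset.univ.val := by
  rw [charpoly_mul_comm, ← mul_assoc, hV, one_mul, charpoly_diagonal, Polynomial.roots_prod]
  · simp
  · simp [Finset.prod_ne_zero_iff, Polynomial.X_sub_C_ne_zero]

theorem iPos_conj_diagonal {V : Matrix k k ℂ} (hV : Vᴴ * V = 1) (μ : k → ℝ) :
    iPos (V * diagonal (fun i => (μ i : ℂ)) * Vᴴ) = Fintype.card {i // 0 < μ i} := by
  classical
  rw [iPos, roots_charpoly_conj_diagonal hV, Multiset.filter_map, Multiset.card_map, Fintype.card_subtype,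
    Finset.card_def, Finset.filter_val]
  simp

theorem iNeg_conj_diagonal {V : Matrix k k ℂ} (hV : Vᴴ * V = 1) (μ : k → ℝ) :
    iNeg (V * diagonal (fun i => (μ i : ℂ)) * Vᴴ) = Fintype.card {i // μ i < 0} := by
  classical
  rw [iNeg, roots_charpoly_conj_diagonal hV, Multiset.filter_map, Multiset.card_map, Fintype.card_subtype,
    Finset.card_def, Finset.filter_val]
  have h : ∀ x : ℝ, (x : ℂ) < 0 ↔ x < 0 := fun x => by exact_mod_cast Complex.real_lt_real
  simp [h]

theorem iPos_neg {H : Matrix k k ℂ} (hH : H.IsHermitian) : iPos (-H) = iNeg H := by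
  obtain ⟨V, μ, hV, -, rfl⟩ := exists_spectral hH
  have : -(V * diagonal (fun i => (μ i : ℂ)) * Vᴴ) =
      V * diagonal (fun i => ((-μ i : ℝ) : ℂ)) * Vᴴ := by
    have : diagonal (fun i => ((-μ i : ℝ) : ℂ)) = -diagonal (fun i => (μ i : ℂ)) := by
      rw [diagonal_neg]; simp
    rw [this, Matrix.mul_neg, Matrix.neg_mul]
  rw [this, iPos_conj_diagonal hV, iNeg_conj_diagonal hV]
  simp

theorem iNeg_neg {H : Matrix k k ℂ} (hH : H.IsHermitian) : iNeg (-H) = iPos H := by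
  rw [← iPos_neg hH.neg, neg_neg]

theorem rk_eq_iPos_add_iNeg {H : Matrix k k ℂ} (hH : H.IsHermitian) : rk H = iPos H + iNeg H := by
  obtain ⟨V, μ, hV, hV', rfl⟩ := exists_spectral hH
  rw [iPos_conj_diagonal hV, iNeg_conj_diagonal hV]
  have hd : IsUnit V.det := (isUnit_iff_isUnit_det V).1 ⟨⟨V, Vᴴ, hV', hV⟩, rfl⟩
  have hd' : IsUnit Vᴴ.det := (isUnit_iff_isUnit_det Vᴴ).1 ⟨⟨Vᴴ, V, hV, hV'⟩, rfl⟩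
  rw [rk, rank_mul_eq_left_of_isUnit_det _ _ hd', rank_mul_eq_right_of_isUnit_det _ _ hd,
    rank_diagonal, ← Nat.cast_add]
  congr 1
  simp only [Fintype.card_subtype]
  rw [← Finset.card_union_of_disjoint]
  · congr 1
    ext i
    simp [lt_or_lt_iff_ne, or_comm]
  · rw [Finset.disjoint_filter]
    intro i _ h
    exact h.not_gt

theorem iPos_nonneg (H : Matrix k k ℂ) : 0 ≤ iPos H := Int.natCast_nonneg _

theorem iNeg_nonneg (H : Matrix k k ℂ) : 0 ≤ iNeg H := Int.natCast_nonneg _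

theorem rk_nonneg (H : Matrix k l ℂ) : 0 ≤ rk H := Int.natCast_nonneg _

theorem quadForm_diagonal (μ : k → ℝ) (z : k → ℂ) :
    star z ⬝ᵥ (diagonal (fun i => (μ i : ℂ)) *ᵥ z) = ((∑ i, μ i * ‖z i‖ ^ 2 : ℝ) : ℂ) := by
  rw [dotProduct]
  push_cast
  refine Finset.sum_congr rfl fun i _ => ?_
  rw [mulVec_diagonal, Pi.star_apply, ← Complex.conj_mul', Complex.star_def]
  ring

/-- A compression `Pᴴ H P`, with `P` of any shape, has at most as many positive eigenvalues as `H`: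
the image under `P` of a subspace on which `Pᴴ H P` is positive definite meets the span of the
nonpositive eigenvectors of `H` trivially. -/
theorem iPos_conjTranspose_mul_mul_le {H : Matrix k k ℂ} (hH : H.IsHermitian) (P : Matrix k l ℂ) :
    iPos (Pᴴ * H * P) ≤ iPos H := by
  obtain ⟨V, μ, hV, hV', hVH⟩ := exists_spectral hH
  obtain ⟨W, ν, hW, hW', hWH⟩ := exists_spectral (isHermitian_conjTranspose_mul_mul P hH)
  rw [hWH, iPos_conj_diagonal hW, hVH, iPos_conj_diagonal hV]
  by_contra! hlt
  have hlt' : Fintype.card {i // 0 < μ i} < Fintype.card {i // 0 < ν i} := by exact_mod_cast hlt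
  let Q := Vᴴ * P * W
  -- `z` in the kernel of `f` is a combination of eigenvectors of `Pᴴ H P` with positive eigenvalues
  -- whose image under `P` has no component along eigenvectors of `H` with positive eigenvalues
  let f : (l → ℂ) →ₗ[ℂ] ({i // ¬ 0 < ν i} → ℂ) × ({j // 0 < μ j} → ℂ) :=
    (LinearMap.funLeft ℂ ℂ Subtype.val).prod
      ((LinearMap.funLeft ℂ ℂ Subtype.val).comp Q.mulVecLin)
  have hker : LinearMap.ker f ≠ ⊥ := by
    apply LinearMap.ker_ne_bot_of_finrank_lt
    have h1 := Fintype.card_subtype_compl (fun i => 0 < ν i)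
    have h2 := Fintype.card_subtype_le (fun i => 0 < ν i)
    simp only [Module.finrank_prod, Module.finrank_pi]
    omega
  obtain ⟨z, hz, hz0⟩ := Submodule.exists_mem_ne_zero_of_ne_bot hker
  have hz' := LinearMap.mem_ker.1 hz
  have hzν : ∀ i, ¬ 0 < ν i → z i = 0 := fun i hi =>
    congrFun (congrArg Prod.fst hz') ⟨i, hi⟩
  have hzμ : ∀ j, 0 < μ j → (Q *ᵥ z) j = 0 := fun j hj =>
    congrFun (congrArg Prod.snd hz') ⟨j, hj⟩
  have key : diagonal (fun i => (ν i : ℂ)) = Qᴴ * diagonal (fun i => (μ i : ℂ)) * Q := by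
    calc diagonal (fun i => (ν i : ℂ))
        = (Wᴴ * W) * diagonal (fun i => (ν i : ℂ)) * (Wᴴ * W) := by rw [hW]; simp
      _ = Wᴴ * (Pᴴ * H * P) * W := by rw [hWH]; simp only [Matrix.mul_assoc]
      _ = _ := by
        rw [hVH]; simp only [Q, conjTranspose_mul, conjTranspose_conjTranspose, Matrix.mul_assoc]
  have e1 := quadForm_diagonal ν z
  have e2 := quadForm_diagonal μ (Q *ᵥ z)
  rw [key, ← mulVec_mulVec, ← mulVec_mulVec, dotProduct_mulVec, ← star_mulVec, e2] at e1
  have e3 : ∑ i, μ i * ‖(Q *ᵥ z) i‖ ^ 2 = ∑ i, ν i * ‖z i‖ ^ 2 := by exact_mod_cast e1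
  have h1 : ∑ i, μ i * ‖(Q *ᵥ z) i‖ ^ 2 ≤ 0 := by
    refine Finset.sum_nonpos fun i _ => ?_
    by_cases hi : 0 < μ i
    · simp [hzμ i hi]
    · exact mul_nonpos_of_nonpos_of_nonneg (not_lt.1 hi) (by positivity)
  have h2 : 0 < ∑ i, ν i * ‖z i‖ ^ 2 := by
    obtain ⟨i, hi⟩ := Function.ne_iff.1 hz0
    refine Finset.sum_pos' (fun j _ => ?_) ⟨i, Finset.mem_univ _, ?_⟩
    · by_cases hj : 0 < ν j
      · positivity
      · simp [hzν j hj]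
    · have : 0 < ν i := by by_contra h; exact hi (hzν i h)
      have : 0 < ‖z i‖ := norm_pos_iff.2 hi
      positivity
  linarith

theorem iNeg_conjTranspose_mul_mul_le {H : Matrix k k ℂ} (hH : H.IsHermitian) (P : Matrix k l ℂ) :
    iNeg (Pᴴ * H * P) ≤ iNeg H := by
  rw [← iPos_neg hH, ← iPos_neg (isHermitian_conjTranspose_mul_mul P hH)]
  simpa using iPos_conjTranspose_mul_mul_le hH.neg P

/-- Sylvester's law of inertia. Only a right inverse of `P` is needed, so `P` may have more columns
than rows. -/
theorem iPos_congr {H : Matrix k k ℂ} (hH : H.IsHermitian) (P : Matrix k l ℂ) (P' : Matrix l k ℂ)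
    (hP : P * P' = 1) : iPos (Pᴴ * H * P) = iPos H := by
  refine le_antisymm (iPos_conjTranspose_mul_mul_le hH P) ?_
  have h := iPos_conjTranspose_mul_mul_le (isHermitian_conjTranspose_mul_mul P hH) P'
  have e : P'ᴴ * (Pᴴ * H * P) * P' = (P * P')ᴴ * H * (P * P') := by
    simp only [conjTranspose_mul, Matrix.mul_assoc]
  rwa [e, hP, conjTranspose_one, Matrix.one_mul, Matrix.mul_one] at h

theorem iNeg_congr {H : Matrix k k ℂ} (hH : H.IsHermitian) (P : Matrix k l ℂ) (P' : Matrix l k ℂ)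
    (hP : P * P' = 1) : iNeg (Pᴴ * H * P) = iNeg H := by
  rw [← iPos_neg hH, ← iPos_neg (isHermitian_conjTranspose_mul_mul P hH)]
  simpa using iPos_congr hH.neg P P' hP

theorem iPos_fromBlocks_diag (H : Matrix k k ℂ) (K : Matrix l l ℂ) :
    iPos (fromBlocks H 0 0 K) = iPos H + iPos K := by
  classical
  rw [iPos, charpoly_fromBlocks_zero₁₂, Polynomial.roots_mul, Multiset.filter_add,
    Multiset.card_add, Nat.cast_add]
  · rfl
  · exact mul_ne_zero (charpoly_monic H).ne_zero (charpoly_monic K).ne_zero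

theorem iNeg_fromBlocks_diag (H : Matrix k k ℂ) (K : Matrix l l ℂ) :
    iNeg (fromBlocks H 0 0 K) = iNeg H + iNeg K := by
  classical
  rw [iNeg, charpoly_fromBlocks_zero₁₂, Polynomial.roots_mul, Multiset.filter_add,
    Multiset.card_add, Nat.cast_add]
  · rfl
  · exact mul_ne_zero (charpoly_monic H).ne_zero (charpoly_monic K).ne_zero

theorem posDef_iff_iPos {H : Matrix k k ℂ} (hH : H.IsHermitian) :
    H.PosDef ↔ iPos H = Fintype.card k := by
  rw [hH.posDef_iff_eigenvalues_pos]
  have h : iPos H = Fintype.card {i // 0 < hH.eigenvalues i} := by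
    conv_lhs => rw [show H = _ from hH.spectral_theorem]
    exact iPos_conj_diagonal (Unitary.coe_star_mul_self _) hH.eigenvalues
  rw [h, Nat.cast_inj, Fintype.card_subtype, ← Finset.card_univ, Finset.card_filter_eq_iff]
  simp

theorem posSemidef_iff_iNeg {H : Matrix k k ℂ} (hH : H.IsHermitian) :
    H.PosSemidef ↔ iNeg H = 0 := by
  rw [hH.posSemidef_iff_eigenvalues_nonneg]
  have h : iNeg H = Fintype.card {i // hH.eigenvalues i < 0} := by
    conv_lhs => rw [show H = _ from hH.spectral_theorem]
    exact iNeg_conj_diagonal (Unitary.coe_star_mul_self _) hH.eigenvalues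
  rw [h, Nat.cast_eq_zero, Fintype.card_subtype, Finset.card_eq_zero, Finset.filter_eq_empty_iff]
  simp [Pi.le_def]

theorem neg_posDef_iff_iNeg {H : Matrix k k ℂ} (hH : H.IsHermitian) :
    (-H).PosDef ↔ iNeg H = Fintype.card k := by
  rw [posDef_iff_iPos hH.neg, iPos_neg hH]

theorem neg_posSemidef_iff_iPos {H : Matrix k k ℂ} (hH : H.IsHermitian) :
    (-H).PosSemidef ↔ iPos H = 0 := by
  rw [posSemidef_iff_iNeg hH.neg, iNeg_neg hH]

theorem isUnit_iff_rk {H : Matrix k k ℂ} : IsUnit H ↔ rk H = Fintype.card k := by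
  rw [rk, Nat.cast_inj]
  refine ⟨rank_of_isUnit H, fun h => ?_⟩
  have hr : LinearMap.range H.mulVecLin = ⊤ := by
    apply Submodule.eq_top_of_finrank_eq
    rw [Module.finrank_pi]
    exact h
  rw [← mulVec_surjective_iff_isUnit]
  exact LinearMap.range_eq_top.1 hr

theorem rk_eq_zero_iff {H : Matrix k l ℂ} : rk H = 0 ↔ H = 0 := by
  rw [rk, Nat.cast_eq_zero]
  refine ⟨fun h => ?_, fun h => by rw [h, rank_zero]⟩
  have h' : LinearMap.range H.mulVecLin = ⊥ := Submodule.finrank_eq_zero.1 h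
  have h'' := LinearMap.range_eq_bot.1 h'
  ext i j
  simpa using congrFun (LinearMap.congr_fun h'' (Pi.single j 1)) i

theorem rk_le_card (H : Matrix k k ℂ) : rk H ≤ Fintype.card k :=
  Nat.cast_le.2 (rank_le_card_width H)

theorem iPos_eq_of_posDef {H : Matrix k k ℂ} (h : H.PosDef) : iPos H = Fintype.card k :=
  (posDef_iff_iPos h.1).1 h

end

/-! ### The inertia pair and orthonormal rank factorizations -/

section

variable {k l p q : Type} [Fintype k] [DecidableEq k] [Fintype l] [DecidableEq l]
  [Fintype p] [DecidableEq p] [Fintype q] [DecidableEq q]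

/-- The pair `(i₊(H), i₋(H))` in `ℤ × ℤ`, with the componentwise order, so that statements about both
inertia indices can be made at once. -/
noncomputable def inertia (H : Matrix k k ℂ) : ℤ × ℤ := (iPos H, iNeg H)

theorem inertia_neg {H : Matrix k k ℂ} (hH : H.IsHermitian) :
    inertia (-H) = (inertia H).swap := by
  simp [inertia, iPos_neg hH, iNeg_neg hH]

theorem inertia_congr {H : Matrix k k ℂ} (hH : H.IsHermitian) (P : Matrix k l ℂ)
    (P' : Matrix l k ℂ) (hP : P * P' = 1) : inertia (Pᴴ * H * P) = inertia H :=
  Prod.ext (iPos_congr hH P P' hP) (iNeg_congr hH P P' hP)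

theorem inertia_conjTranspose_mul_mul_le {H : Matrix k k ℂ} (hH : H.IsHermitian)
    (P : Matrix k l ℂ) : inertia (Pᴴ * H * P) ≤ inertia H :=
  ⟨iPos_conjTranspose_mul_mul_le hH P, iNeg_conjTranspose_mul_mul_le hH P⟩

theorem inertia_fromBlocks_diag (H : Matrix k k ℂ) (K : Matrix l l ℂ) :
    inertia (fromBlocks H 0 0 K) = inertia H + inertia K :=
  Prod.ext (iPos_fromBlocks_diag H K) (iNeg_fromBlocks_diag H K)

theorem isHermitian_fromBlocks {H : Matrix k k ℂ} {K : Matrix l l ℂ} (hH : H.IsHermitian)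
    (hK : K.IsHermitian) (C : Matrix k l ℂ) : (fromBlocks H C Cᴴ K).IsHermitian :=
  isHermitian_fromBlocks_iff.2 ⟨hH, rfl, conjTranspose_conjTranspose C, hK⟩

theorem inertia_reindex (e : k ≃ l) (H : Matrix k k ℂ) :
    inertia (H.submatrix e.symm e.symm) = inertia H := by
  have h : (H.submatrix e.symm e.symm).charpoly = H.charpoly := charpoly_reindex e H
  simp only [inertia, iPos, iNeg, h]

/-- The hyperbolic form on `ℂ^k ⊕ ℂ^k` has `|k|` positive and `|k|` negative eigenvalues. -/
theorem inertia_hyperbolic :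
    inertia (fromBlocks 0 1 1 0 : Matrix (k ⊕ k) (k ⊕ k) ℂ)
      = ((Fintype.card k : ℤ), (Fintype.card k : ℤ)) := by
  set H : Matrix (k ⊕ k) (k ⊕ k) ℂ := fromBlocks 0 1 1 0
  have hH : H.IsHermitian := by
    have := isHermitian_fromBlocks (isHermitian_zero (α := ℂ) (n := k))
      (isHermitian_zero (α := ℂ) (n := k)) 1
    rwa [conjTranspose_one] at this
  have h1 : iPos (1 : Matrix k k ℂ) = Fintype.card k := iPos_eq_of_posDef PosDef.one
  have hp : (Fintype.card k : ℤ) ≤ iPos H := by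
    have h := iPos_conjTranspose_mul_mul_le hH (fromRows 1 ((1/2 : ℂ) • 1) : Matrix (k ⊕ k) k ℂ)
    convert h
    rw [← h1]
    congr 1
    simp [H, conjTranspose_fromRows_eq_fromCols_conjTranspose, fromCols_mul_fromBlocks,
      fromCols_mul_fromRows, ← add_smul]
    norm_num
  have hn : (Fintype.card k : ℤ) ≤ iNeg H := by
    have h := iNeg_conjTranspose_mul_mul_le hH (fromRows 1 ((-1/2 : ℂ) • 1) : Matrix (k ⊕ k) k ℂ)
    convert h
    rw [← h1, ← iNeg_neg isHermitian_one]
    congr 1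
    simp [H, conjTranspose_fromRows_eq_fromCols_conjTranspose, fromCols_mul_fromBlocks,
      fromCols_mul_fromRows, ← add_smul]
  have hr := rk_le_card H
  rw [rk_eq_iPos_add_iNeg hH, Fintype.card_sum] at hr
  push_cast at hr
  ext <;> simp only [inertia] <;> linarith

/-- A rank factorization `C = Q R` in which the columns of `Q` are an orthonormal basis of the column
space of `C`, together with an orthonormal basis of the orthogonal complement of the column space. -/
structure RankFactorization (C : Matrix k l ℂ) where
  /-- The rank of `C`, see `RankFactorization.rk_eq`. -/
  r : ℕ
  /-- The dimension of the complement of the column space. -/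
  t : ℕ
  /-- An orthonormal basis of the column space. -/
  Q : Matrix k (Fin r) ℂ
  /-- An orthonormal basis of the complement of the column space. -/
  F : Matrix k (Fin t) ℂ
  /-- The coordinates of the columns of `C` with respect to `Q`. -/
  R : Matrix (Fin r) l ℂ
  /-- A right inverse of `R`. -/
  S : Matrix l (Fin r) ℂ
  QQ : Qᴴ * Q = 1
  FF : Fᴴ * F = 1
  QF : Qᴴ * F = 0
  compl : Q * Qᴴ + F * Fᴴ = 1
  eq : Q * R = C
  RS : R * S = 1

/-- The columns of `Q` are the eigenvectors of `C Cᴴ` with nonzero eigenvalue, those of `F` the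
remaining eigenvectors. -/
theorem nonempty_rankFactorization (C : Matrix k l ℂ) : Nonempty (RankFactorization C) := by
  obtain ⟨V, μ, hV, hV', hC⟩ := exists_spectral (isHermitian_mul_conjTranspose_self C)
  let a := {i // μ i ≠ 0}
  let b := {i // ¬ μ i ≠ 0}
  let ea := (Fintype.equivFin a).symm
  let eb := (Fintype.equivFin b).symm
  let fa : Fin (Fintype.card a) → k := fun i => (ea i).1
  let fb : Fin (Fintype.card b) → k := fun i => (eb i).1
  have ha : Function.Injective fa := Subtype.val_injective.comp ea.injective
  have hb : Function.Injective fb := Subtype.val_injective.comp eb.injective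
  have hVV : ∀ {x y : Type} (f : x → k) (g : y → k),
      (V.submatrix id f)ᴴ * V.submatrix id g = (1 : Matrix k k ℂ).submatrix f g := by
    intro x y f g
    rw [conjTranspose_submatrix, ← submatrix_mul _ _ _ _ _ Function.bijective_id, hV]
  have hsum : V.submatrix id fa * (V.submatrix id fa)ᴴ +
      V.submatrix id fb * (V.submatrix id fb)ᴴ = 1 := by
    rw [← hV']
    ext i j
    simp only [Matrix.add_apply, mul_apply, conjTranspose_apply, submatrix_apply, id]
    rw [← Fintype.sum_subtype_add_sum_subtype (fun i => μ i ≠ 0),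
      ← Equiv.sum_comp ea, ← Equiv.sum_comp eb]
  have hCC : Vᴴ * (C * Cᴴ) = diagonal (fun i => (μ i : ℂ)) * Vᴴ := by
    rw [hC, ← Matrix.mul_assoc, ← Matrix.mul_assoc, hV, Matrix.one_mul]
  have hCF : (V.submatrix id fb)ᴴ * C = 0 := by
    have h : ((V.submatrix id fb)ᴴ * C) * ((V.submatrix id fb)ᴴ * C)ᴴ = 0 := by
      rw [conjTranspose_mul, conjTranspose_conjTranspose, Matrix.mul_assoc, ← Matrix.mul_assoc C]
      have : (V.submatrix id fb)ᴴ * (C * Cᴴ) = (Vᴴ * (C * Cᴴ)).submatrix fb id := by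
        rw [conjTranspose_submatrix, submatrix_mul _ _ _ _ _ Function.bijective_id,
          submatrix_id_id]
      rw [← Matrix.mul_assoc, this, hCC]
      have : (diagonal (fun i => (μ i : ℂ)) * Vᴴ).submatrix fb id = 0 := by
        ext i j
        have : μ (fb i) = 0 := not_not.1 (eb i).2
        simp [diagonal_mul, this]
      rw [this, Matrix.zero_mul]
    exact self_mul_conjTranspose_eq_zero.1 h
  have hQF : (V.submatrix id fa)ᴴ * V.submatrix id fb = 0 := by
    rw [hVV]
    ext i j
    have : fa i ≠ fb j := fun h => (eb j).2 (by
      have := (ea i).2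
      change μ (fa i) ≠ 0 at this
      rw [h] at this; exact this)
    simp [one_apply, this]
  have hQS : V.submatrix id fa =
      C * (Cᴴ * V.submatrix id fa * diagonal (fun i => ((μ (fa i))⁻¹ : ℂ))) := by
    have h2 : (C * Cᴴ) * V = V * diagonal (fun i => (μ i : ℂ)) := by
      rw [hC, Matrix.mul_assoc, hV, Matrix.mul_one]
    have h3 : (C * Cᴴ) * V.submatrix id fa = (V * diagonal (fun i => (μ i : ℂ))).submatrix id fa := by
      rw [← h2, submatrix_mul _ _ _ _ _ Function.bijective_id, submatrix_id_id]
    rw [← Matrix.mul_assoc, ← Matrix.mul_assoc, h3]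
    ext i j
    have : (μ (fa j) : ℂ) ≠ 0 := by exact_mod_cast (ea j).2
    simp [mul_diagonal, this]
  have hQQ : (V.submatrix id fa)ᴴ * V.submatrix id fa = 1 := by
    rw [hVV, submatrix_one _ ha]
  refine ⟨{
    r := Fintype.card a
    t := Fintype.card b
    Q := V.submatrix id fa
    F := V.submatrix id fb
    R := (V.submatrix id fa)ᴴ * C
    S := Cᴴ * V.submatrix id fa * diagonal (fun i => ((μ (fa i))⁻¹ : ℂ))
    QQ := hQQ
    FF := by rw [hVV, submatrix_one _ hb]
    QF := hQF
    compl := hsum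
    eq := ?_
    RS := ?_ }⟩
  · have h := congrArg (· * C) hsum
    simp only [Matrix.add_mul, Matrix.mul_assoc, hCF, Matrix.mul_zero, add_zero,
      Matrix.one_mul] at h
    exact h
  · rw [Matrix.mul_assoc, ← hQS, hQQ]

namespace RankFactorization

variable {C : Matrix k l ℂ} (D : RankFactorization C)

theorem FQ : D.Fᴴ * D.Q = 0 := by
  have := congrArg conjTranspose D.QF
  simpa using this

theorem QQ_mul (X : Matrix (Fin D.r) p ℂ) : D.Qᴴ * (D.Q * X) = X := by
  rw [← Matrix.mul_assoc, D.QQ, Matrix.one_mul]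

theorem FQ_mul (X : Matrix (Fin D.r) p ℂ) : D.Fᴴ * (D.Q * X) = 0 := by
  rw [← Matrix.mul_assoc, D.FQ, Matrix.zero_mul]

theorem RS_mul (X : Matrix (Fin D.r) p ℂ) : D.R * (D.S * X) = X := by
  rw [← Matrix.mul_assoc, D.RS, Matrix.one_mul]

theorem fromRows_mul_fromCols_eq_one :
    fromRows D.Qᴴ D.Fᴴ * fromCols D.Q D.F = 1 := by
  rw [fromRows_mul_fromCols, D.QQ, D.QF, D.FQ, D.FF, fromBlocks_one]

theorem fromCols_mul_fromRows_eq_one :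
    fromCols D.Q D.F * fromRows D.Qᴴ D.Fᴴ = 1 := by
  rw [fromCols_mul_fromRows, D.compl]

theorem mul_S : C * D.S = D.Q :=
  calc C * D.S = D.Q * D.R * D.S := congrArg (· * D.S) D.eq.symm
    _ = D.Q := by rw [Matrix.mul_assoc, D.RS, Matrix.mul_one]

theorem F_mul : D.Fᴴ * C = 0 :=
  calc D.Fᴴ * C = D.Fᴴ * (D.Q * D.R) := congrArg (D.Fᴴ * ·) D.eq.symm
    _ = 0 := D.FQ_mul _

theorem conjTranspose_eq : D.Rᴴ * D.Qᴴ = Cᴴ := by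
  rw [← conjTranspose_mul, D.eq]

theorem rk_eq : rk C = D.r := by
  rw [rk, Nat.cast_inj]
  apply le_antisymm
  · calc C.rank = (D.Q * D.R).rank := by rw [D.eq]
      _ ≤ D.Q.rank := rank_mul_le_left _ _
      _ ≤ Fintype.card (Fin D.r) := rank_le_card_width _
      _ = D.r := Fintype.card_fin _
  · calc D.r = (1 : Matrix (Fin D.r) (Fin D.r) ℂ).rank := by rw [rank_one, Fintype.card_fin]
      _ = (D.Qᴴ * C * D.S).rank := by
        rw [Matrix.mul_assoc, D.mul_S, D.QQ]
      _ ≤ (D.Qᴴ * C).rank := rank_mul_le_left _ _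
      _ ≤ C.rank := rank_mul_le_right _ _

theorem r_add_t : D.r + D.t = Fintype.card k := by
  apply le_antisymm
  · have h := (rank_mul_le_left (fromRows D.Qᴴ D.Fᴴ) (fromCols D.Q D.F)).trans
      (rank_le_card_width _)
    rwa [D.fromRows_mul_fromCols_eq_one, rank_one, Fintype.card_sum, Fintype.card_fin,
      Fintype.card_fin] at h
  · have h := (rank_mul_le_left (fromCols D.Q D.F) (fromRows D.Qᴴ D.Fᴴ)).trans
      (rank_le_card_width _)
    rwa [D.fromCols_mul_fromRows_eq_one, rank_one, Fintype.card_sum, Fintype.card_fin,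
      Fintype.card_fin] at h

end RankFactorization

end

/-! ### Inertia and rank of bordered matrices -/

section

variable {k l p q : Type} [Fintype k] [DecidableEq k] [Fintype l] [DecidableEq l]
  [Fintype p] [DecidableEq p] [Fintype q] [DecidableEq q]

theorem fromCols_add_fromCols (A A' : Matrix k l ℂ) (B B' : Matrix k p ℂ) :
    fromCols A B + fromCols A' B' = fromCols (A + A') (B + B') := by
  ext i (j | j) <;> rfl

theorem fromRows_add_fromRows (A A' : Matrix k l ℂ) (B B' : Matrix p l ℂ) :
    fromRows A B + fromRows A' B' = fromRows (A + A') (B + B') := by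
  ext (i | i) j <;> rfl

theorem inertia_fromBlocks_mul_right {H : Matrix k k ℂ} {K : Matrix p p ℂ} (hH : H.IsHermitian)
    (hK : K.IsHermitian) (C : Matrix k p ℂ) {R : Matrix p l ℂ} {S : Matrix l p ℂ} (hRS : R * S = 1) :
    inertia (fromBlocks H (C * R) (C * R)ᴴ (Rᴴ * K * R)) = inertia (fromBlocks H C Cᴴ K) := by
  rw [← inertia_congr (isHermitian_fromBlocks hH hK C) (fromBlocks 1 0 0 R : Matrix (k ⊕ p) (k ⊕ l) ℂ)
    (fromBlocks 1 0 0 S)]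
  · congr 1
    simp [fromBlocks_conjTranspose, fromBlocks_multiply]
  · simp [fromBlocks_multiply, hRS]

theorem inertia_fromBlocks_swap (H : Matrix k k ℂ) (K : Matrix p p ℂ) (C : Matrix k p ℂ) :
    inertia (fromBlocks K Cᴴ C H) = inertia (fromBlocks H C Cᴴ K) := by
  rw [← inertia_reindex (Equiv.sumComm p k) (fromBlocks K Cᴴ C H)]
  congr 1
  exact fromBlocks_submatrix_sum_swap_sum_swap _ _ _ _

namespace RankFactorization

variable {C : Matrix k l ℂ} (D : RankFactorization C)

/-- A Hermitian matrix with a zero diagonal block: each dimension of the column space of `C` contributes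
a hyperbolic plane, and what remains of `B` is its compression to the complement of the column
space. -/
theorem inertia_fromBlocks_zero {B : Matrix k k ℂ} (hB : B.IsHermitian) :
    inertia (fromBlocks B C Cᴴ 0) = ((D.r : ℤ), (D.r : ℤ)) + inertia (D.Fᴴ * B * D.F) := by
  have h0 : (0 : Matrix (Fin D.r) (Fin D.r) ℂ).IsHermitian := isHermitian_zero
  have h1 := inertia_fromBlocks_mul_right hB h0 D.Q D.RS
  rw [Matrix.mul_zero, Matrix.zero_mul, D.eq] at h1
  rw [h1]
  -- the columns of `F`, corrected by `-Qᴴ B F`, are orthogonal to the hyperbolic part, and the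
  -- correction `-Qᴴ B Q / 2` makes the columns of `Q` isotropic
  rw [← inertia_congr (isHermitian_fromBlocks hB h0 D.Q)
    (fromBlocks D.F (fromCols D.Q 0) (-(D.Qᴴ * B * D.F))
      (fromCols ((-1/2 : ℂ) • (D.Qᴴ * B * D.Q)) 1) :
      Matrix (k ⊕ Fin D.r) (Fin D.t ⊕ (Fin D.r ⊕ Fin D.r)) ℂ)
    (fromBlocks D.Fᴴ 0 (fromRows D.Qᴴ (D.Qᴴ * B * D.F * D.Fᴴ + (1/2 : ℂ) • (D.Qᴴ * B * D.Q * D.Qᴴ)))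
      (fromRows 0 1))]
  · have h2 := inertia_hyperbolic (k := Fin D.r)
    rw [Fintype.card_fin] at h2
    rw [← h2, add_comm, ← inertia_fromBlocks_diag]
    congr 1
    rw [fromBlocks_conjTranspose, fromBlocks_multiply, fromBlocks_multiply]
    simp only [conjTranspose_fromCols_eq_fromRows_conjTranspose, mul_fromCols, fromRows_mul,
      fromCols_add_fromCols, fromRows_add_fromRows, conjTranspose_neg, conjTranspose_mul,
      conjTranspose_smul, conjTranspose_conjTranspose, hB.eq, conjTranspose_zero, conjTranspose_one,
      Matrix.mul_zero, Matrix.zero_mul, Matrix.mul_one, Matrix.one_mul, add_zero, zero_add,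
      D.QQ, D.FQ, D.QF, Matrix.add_mul, Matrix.neg_mul, Matrix.mul_assoc, neg_zero,
      Matrix.smul_mul, Matrix.mul_smul, smul_zero]
    rw [fromBlocks_inj]
    refine ⟨rfl, ?_, ?_, ?_⟩
    · rw [add_neg_cancel]
    · rw [add_neg_cancel]
      ext (i | i) j <;> rfl
    · rw [← fromCols_fromRows_eq_fromBlocks]
      congr 2
      ext (i | i) j
      · simp
        ring
      · simp
  · rw [fromBlocks_multiply]
    simp only [fromCols_mul_fromRows]
    rw [← fromBlocks_one]
    congr 1
    · rw [Matrix.zero_mul, add_zero, add_comm, D.compl]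
    · simp
    · simp [Matrix.mul_assoc]
      module
    · simp

end RankFactorization

/-- If `C` lives on the kernel of `E`, in the sense that it factors through a projection `J` with
`E J = 0`, then the block `E` splits off. -/
theorem inertia_fromBlocks_decouple {K : Matrix k k ℂ} {E : Matrix l l ℂ} (hK : K.IsHermitian)
    (hE : E.IsHermitian) {C : Matrix k l ℂ} {J : Matrix l l ℂ} (hJ : J.IsHermitian) 
    (hEJ : E * J = 0) (hCJ : C * J = C) :
    inertia (fromBlocks K C Cᴴ E) = inertia (fromBlocks K C Cᴴ 0) + inertia E := by
  have h0 : (0 : Matrix l l ℂ).IsHermitian := isHermitian_zero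
  have hJE : J * E = 0 := by
    have := congrArg conjTranspose hEJ
    rwa [conjTranspose_mul, hJ.eq, hE.eq, conjTranspose_zero] at this
  have hJC : J * Cᴴ = Cᴴ := by
    have := congrArg conjTranspose hCJ
    rwa [conjTranspose_mul, hJ.eq] at this
  have hC : C * (1 - J) = 0 := by rw [Matrix.mul_sub, hCJ, Matrix.mul_one, sub_self]
  have hEJ' : E * (1 - J) = E := by rw [Matrix.mul_sub, hEJ, Matrix.mul_one, sub_zero]
  rw [← inertia_fromBlocks_diag]
  have hH : (fromBlocks (fromBlocks K C Cᴴ 0) 0 0 E).IsHermitian := by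
    have := isHermitian_fromBlocks (isHermitian_fromBlocks hK h0 C) hE 0
    rwa [conjTranspose_zero] at this
  apply le_antisymm
  -- the block matrix is the compression of the direct sum along `(x, y) ↦ (x, y, y)`, and conversely
  -- the direct sum is the compression along `(x, y, z) ↦ (x, J y + (1 - J) z)`
  · have h := inertia_conjTranspose_mul_mul_le hH
      (fromRows 1 (fromCols 0 1) : Matrix ((k ⊕ l) ⊕ l) (k ⊕ l) ℂ)
    refine le_of_eq_of_le (congrArg inertia ?_) h
    rw [conjTranspose_fromRows_eq_fromCols_conjTranspose, fromCols_mul_fromBlocks,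
      fromCols_mul_fromRows]
    simp [conjTranspose_fromCols_eq_fromRows_conjTranspose, ]
    ext (i | i) (j | j) <;> simp
  · have h := inertia_conjTranspose_mul_mul_le (isHermitian_fromBlocks hK hE C)
      (fromCols (fromBlocks 1 0 0 J) (fromRows 0 (1 - J)) : Matrix (k ⊕ l) ((k ⊕ l) ⊕ l) ℂ)
    refine le_of_eq_of_le (congrArg inertia ?_) h
    rw [conjTranspose_fromCols_eq_fromRows_conjTranspose, fromRows_mul, fromRows_mul_fromCols]
    simp only [fromBlocks_conjTranspose, conjTranspose_fromRows_eq_fromCols_conjTranspose,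
      fromBlocks_multiply, fromBlocks_mul_fromRows, fromCols_mul_fromBlocks, fromCols_mul_fromRows]
    simp [hJ.eq, hJE, hEJ, hJC, hCJ, hC, hEJ', Matrix.sub_mul]

theorem rk_conjTranspose_mul_self (X : Matrix k l ℂ) : rk (Xᴴ * X) = rk X := by
  rw [rk, rk, rank_conjTranspose_mul_self]

theorem rk_conjTranspose (X : Matrix k l ℂ) : rk Xᴴ = rk X := by
  rw [rk, rk, rank_conjTranspose]

theorem rk_mul_le_left (X : Matrix k l ℂ) (Y : Matrix l p ℂ) : rk (X * Y) ≤ rk X :=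
  Nat.cast_le.2 (rank_mul_le_left X Y)

theorem rk_mul_le_right (X : Matrix k l ℂ) (Y : Matrix l p ℂ) : rk (X * Y) ≤ rk Y :=
  Nat.cast_le.2 (rank_mul_le_right X Y)

theorem rk_one : rk (1 : Matrix k k ℂ) = Fintype.card k := by
  rw [rk, rank_one]

theorem rk_fromBlocks_diag (X : Matrix k l ℂ) (Y : Matrix p q ℂ) :
    rk (fromBlocks X 0 0 Y) = rk X + rk Y := by
  have hX := isHermitian_conjTranspose_mul_self X
  have hY := isHermitian_conjTranspose_mul_self Y
  have h0 := isHermitian_fromBlocks hX hY 0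
  rw [conjTranspose_zero] at h0
  rw [← rk_conjTranspose_mul_self, ← rk_conjTranspose_mul_self X, ← rk_conjTranspose_mul_self Y,
    rk_eq_iPos_add_iNeg hX, rk_eq_iPos_add_iNeg hY]
  have : (fromBlocks X 0 0 Y)ᴴ * fromBlocks X 0 0 Y = fromBlocks (Xᴴ * X) 0 0 (Yᴴ * Y) := by
    simp [fromBlocks_conjTranspose, fromBlocks_multiply]
  rw [this, rk_eq_iPos_add_iNeg h0, iPos_fromBlocks_diag, iNeg_fromBlocks_diag]
  ring

/-- Multiplying on both sides by matrices with a one-sided inverse does not change the rank. -/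
theorem rk_mul_mul {P : Matrix p k ℂ} {P' : Matrix k p ℂ} {Q : Matrix l q ℂ} {Q' : Matrix q l ℂ}
    (X : Matrix k l ℂ) (hP : P' * P = 1) (hQ : Q * Q' = 1) : rk (P * X * Q) = rk X := by
  apply le_antisymm
  · exact (rk_mul_le_left _ _).trans (rk_mul_le_right _ _)
  · calc rk X = rk (P' * (P * X * Q) * Q') := by
          congr 1
          calc X = (P' * P) * X * (Q * Q') := by rw [hP, hQ, Matrix.one_mul, Matrix.mul_one]
            _ = _ := by simp only [Matrix.mul_assoc]
      _ ≤ rk (P * X * Q) := (rk_mul_le_left _ _).trans (rk_mul_le_right _ _)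

/-- Appending columns to `C` increases the rank by that of their components orthogonal to the column
space of `C`. -/
theorem RankFactorization.rk_fromCols {C : Matrix k l ℂ} (D : RankFactorization C)
    (B : Matrix k p ℂ) : rk (fromCols C B) = D.r + rk (D.Fᴴ * B) := by
  have h : rk (fromBlocks (1 : Matrix (Fin D.r) (Fin D.r) ℂ) 0 0 (D.Fᴴ * B)) =
      D.r + rk (D.Fᴴ * B) := by
    rw [rk_fromBlocks_diag, rk_one, Fintype.card_fin]
  rw [← h]
  apply le_antisymm
  · have e : fromCols C B = fromCols D.Q D.F *
        (fromBlocks 1 0 0 (D.Fᴴ * B) : Matrix (Fin D.r ⊕ Fin D.t) (Fin D.r ⊕ p) ℂ) *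
        (fromBlocks D.R (D.Qᴴ * B) 0 1 : Matrix (Fin D.r ⊕ p) (l ⊕ p) ℂ) := by
      rw [fromCols_mul_fromBlocks, fromCols_mul_fromBlocks]
      congr 1
      · simp [D.eq]
      · simp only [Matrix.mul_one, Matrix.mul_zero, add_zero, zero_add]
        rw [← Matrix.mul_assoc, ← Matrix.mul_assoc, ← Matrix.add_mul, D.compl, Matrix.one_mul]
    rw [e]
    exact (rk_mul_le_left _ _).trans (rk_mul_le_right _ _)
  · have e : fromBlocks (1 : Matrix (Fin D.r) (Fin D.r) ℂ) 0 0 (D.Fᴴ * B) =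
        fromRows D.Qᴴ D.Fᴴ * fromCols C B *
          (fromBlocks D.S (-(D.S * (D.Qᴴ * B))) 0 1 : Matrix (l ⊕ p) (Fin D.r ⊕ p) ℂ) := by
      rw [fromRows_mul_fromCols, fromBlocks_multiply]
      simp only [Matrix.mul_assoc, Matrix.mul_neg, D.F_mul, Matrix.mul_zero, add_zero,
        Matrix.mul_one, ← Matrix.mul_assoc C, D.mul_S, D.QQ_mul, D.QQ, neg_add_cancel,
        Matrix.zero_mul, neg_zero, zero_add]
    rw [e]
    exact (rk_mul_le_left _ _).trans (rk_mul_le_right _ _)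

/-- A Hermitian Moore–Penrose inverse of `E`. For Hermitian `E` the condition that `E * inv` and `inv * E`
be Hermitian amounts to `comm`. -/
structure PseudoInverse (E : Matrix l l ℂ) where
  /-- The pseudo-inverse. -/
  inv : Matrix l l ℂ
  herm : inv.IsHermitian
  mul_inv_mul : E * inv * E = E
  inv_mul_inv : inv * E * inv = inv
  comm : E * inv = inv * E

theorem nonempty_pseudoInverse {E : Matrix l l ℂ} (hE : E.IsHermitian) :
    Nonempty (PseudoInverse E) := by
  obtain ⟨V, μ, hV, hV', rfl⟩ := exists_spectral hE
  have hVm : ∀ X : Matrix l l ℂ, Vᴴ * (V * X) = X := fun X => by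
    rw [← Matrix.mul_assoc, hV, Matrix.one_mul]
  refine ⟨⟨V * diagonal (fun i => ((μ i)⁻¹ : ℂ)) * Vᴴ, ?_, ?_, ?_, ?_⟩⟩
  · apply isHermitian_mul_mul_conjTranspose
    rw [isHermitian_diagonal_iff]
    intro i
    simp [isSelfAdjoint_iff]
  · have h : ∀ X : Matrix l l ℂ, diagonal (fun i => (μ i : ℂ)) *
        (diagonal (fun i => ((μ i)⁻¹ : ℂ)) * (diagonal (fun i => (μ i : ℂ)) * X)) =
        diagonal (fun i => (μ i : ℂ)) * X := fun X => by
      ext i j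
      by_cases h : (μ i : ℂ) = 0 <;> simp [diagonal_mul, h]
    simp only [Matrix.mul_assoc, hVm, h]
  · have h : ∀ X : Matrix l l ℂ, diagonal (fun i => ((μ i)⁻¹ : ℂ)) *
        (diagonal (fun i => (μ i : ℂ)) * (diagonal (fun i => ((μ i)⁻¹ : ℂ)) * X)) =
        diagonal (fun i => ((μ i)⁻¹ : ℂ)) * X := fun X => by
      ext i j
      by_cases h : (μ i : ℂ) = 0 <;> simp [diagonal_mul, h]
    simp only [Matrix.mul_assoc, hVm, h]
  · simp only [Matrix.mul_assoc, hVm, ← Matrix.mul_assoc (diagonal _) (diagonal _),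
      diagonal_mul_diagonal]
    simp only [mul_comm]


namespace PseudoInverse

variable {E : Matrix l l ℂ} (N : PseudoInverse E)

/-- The orthogonal projection onto the kernel of `E`, for Hermitian `E`. -/
def proj : Matrix l l ℂ := 1 - N.inv * E

theorem proj_isHermitian (hE : E.IsHermitian) : N.proj.IsHermitian := by
  rw [IsHermitian, proj, conjTranspose_sub, conjTranspose_mul, hE.eq, N.herm.eq, conjTranspose_one,
    N.comm]

theorem mul_proj : E * N.proj = 0 := by
  rw [proj, Matrix.mul_sub, ← Matrix.mul_assoc, N.mul_inv_mul, Matrix.mul_one, sub_self]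

theorem proj_mul_proj : N.proj * N.proj = N.proj := by
  conv_lhs => enter [1]; rw [proj]
  rw [Matrix.sub_mul, Matrix.mul_assoc, N.mul_proj, Matrix.mul_zero, Matrix.one_mul, sub_zero]

theorem inv_posSemidef (hE : E.PosSemidef) : N.inv.PosSemidef := by
  have h := hE.conjTranspose_mul_mul_same N.inv
  rwa [N.herm.eq, N.inv_mul_inv] at h

/-- The generalized Schur complement formula. The part of `C` on the range of `E` is eliminated with the
pseudo-inverse and leaves `K - C E⁺ Cᴴ`; the part `C * N.proj` on the kernel of `E` contributes
hyperbolic planes and compresses this complement. -/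
theorem inertia_fromBlocks (hE : E.IsHermitian) {K : Matrix k k ℂ} (hK : K.IsHermitian)
    (C : Matrix k l ℂ) (D : RankFactorization (C * N.proj)) :
    inertia (fromBlocks K C Cᴴ E) = inertia E + ((D.r : ℤ), (D.r : ℤ)) +
      inertia (D.Fᴴ * (K - C * N.inv * Cᴴ) * D.F) := by
  have hΦ : (K - C * N.inv * Cᴴ).IsHermitian :=
    hK.sub (isHermitian_mul_mul_conjTranspose C N.herm)
  have hP := N.proj_isHermitian hE
  rw [add_assoc, ← D.inertia_fromBlocks_zero hΦ, add_comm,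
    ← inertia_fromBlocks_decouple hΦ hE hP N.mul_proj
      (by rw [Matrix.mul_assoc, N.proj_mul_proj]),
    ← inertia_congr (isHermitian_fromBlocks hK hE C)
      (fromBlocks 1 0 (-(N.inv * Cᴴ)) 1) (fromBlocks 1 0 (N.inv * Cᴴ) 1)]
  · congr 1
    have h1 : N.inv * (E * (N.inv * Cᴴ)) = N.inv * Cᴴ := by
      rw [← Matrix.mul_assoc, ← Matrix.mul_assoc, N.inv_mul_inv]
    have h2 : C * N.proj = C - C * (N.inv * E) := by
      rw [proj, Matrix.mul_sub, Matrix.mul_one]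
    rw [h2]
    simp only [fromBlocks_conjTranspose, fromBlocks_multiply, conjTranspose_neg, conjTranspose_mul,
      conjTranspose_one, conjTranspose_zero, conjTranspose_sub, conjTranspose_conjTranspose, hE.eq,
      N.herm.eq, Matrix.mul_neg, Matrix.neg_mul, Matrix.one_mul, Matrix.mul_one, Matrix.zero_mul,
      Matrix.mul_zero, Matrix.add_mul, Matrix.mul_assoc, h1]
    congr 1
    · abel
    · abel
    · rw [← Matrix.mul_assoc E, N.comm, Matrix.mul_assoc]
      abel
    · abel
  · simp [fromBlocks_multiply]

/-- The rank counterpart of `PseudoInverse.inertia_fromBlocks`. -/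
theorem rk_fromRows (C : Matrix k l ℂ) (D : RankFactorization (C * N.proj)) :
    rk (fromRows C E) = rk E + D.r := by
  have hE1 : E * (1 - N.proj) = E := by rw [Matrix.mul_sub, N.mul_proj, Matrix.mul_one, sub_zero]
  have hC : C * N.proj + C * N.inv * E = C := by
    rw [proj, Matrix.mul_sub, Matrix.mul_one, Matrix.mul_assoc, sub_add_cancel]
  rw [← D.rk_eq, add_comm, ← rk_fromBlocks_diag]
  apply le_antisymm
  · have e : fromRows C E = (fromBlocks 1 (C * N.inv) 0 1 : Matrix (k ⊕ l) (k ⊕ l) ℂ) *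
        fromBlocks (C * N.proj) 0 0 E * (fromRows 1 1 : Matrix (l ⊕ l) l ℂ) := by
      rw [fromBlocks_multiply, fromBlocks_mul_fromRows]
      simp [hC]
    rw [e]
    exact (rk_mul_le_left _ _).trans (rk_mul_le_right _ _)
  · have e : fromBlocks (C * N.proj) 0 0 E = 
        (fromBlocks 1 (-(C * N.inv)) 0 1 : Matrix (k ⊕ l) (k ⊕ l) ℂ) * fromRows C E *
        fromCols N.proj (1 - N.proj) := by
      rw [fromBlocks_mul_fromRows, fromRows_mul_fromCols]
      have : C + -(C * N.inv) * E = C * N.proj := by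
        conv_lhs => enter [1]; rw [← hC]
        rw [Matrix.neg_mul, add_neg_cancel_right]
      have h1 : C * N.proj * N.proj = C * N.proj := by rw [Matrix.mul_assoc, N.proj_mul_proj]
      have h0 : C * N.proj * (1 - N.proj) = 0 := by
        rw [Matrix.mul_sub, h1, Matrix.mul_one, sub_self]
      simp only [Matrix.one_mul, Matrix.zero_mul, zero_add, this, N.mul_proj, hE1, h0, h1]
    rw [e]
    exact (rk_mul_le_left _ _).trans (rk_mul_le_right _ _)

end PseudoInverse

end

/-! ### Hermitian least-squares and least-rank solutions -/

theorem frobNorm_sq {m n : ℕ} (C : Matrix (Fin m) (Fin n) ℂ) :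
    frobNorm C ^ 2 = (trace (Cᴴ * C)).re := by
  rw [frobNorm, frobenius_norm_def, ← Real.sqrt_eq_rpow, Real.sq_sqrt (by positivity), trace,
    Complex.re_sum, Finset.sum_comm]
  refine Finset.sum_congr rfl fun j _ => ?_
  rw [diag_apply, mul_apply, Complex.re_sum]
  refine Finset.sum_congr rfl fun i _ => ?_
  rw [conjTranspose_apply, Complex.star_def, Complex.conj_mul', Real.rpow_two]
  norm_cast

theorem trace_conjTranspose_mul_self_re_nonneg {k l : Type} [Fintype k] [Fintype l]
    (V : Matrix k l ℂ) : 0 ≤ (trace (Vᴴ * V)).re :=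
  (Complex.nonneg_iff.1 (posSemidef_conjTranspose_mul_self V).trace_nonneg).1

section

variable {m n : ℕ} {A : Matrix (Fin m) (Fin n) ℂ} {B : Matrix (Fin m) (Fin m) ℂ}

/-- Pythagoras in the Frobenius norm: only the component of the residual in the range of `A` on both sides
depends on `Z`. -/
theorem RankFactorization.trace_residual (D : RankFactorization A)
    (Z : Matrix (Fin n) (Fin n) ℂ) :
    trace ((B - A * Z * Aᴴ)ᴴ * (B - A * Z * Aᴴ)) =
      trace ((B - D.Q * (D.Qᴴ * B * D.Q) * D.Qᴴ)ᴴ * (B - D.Q * (D.Qᴴ * B * D.Q) * D.Qᴴ)) +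
      trace ((D.Qᴴ * B * D.Q - D.R * Z * D.Rᴴ)ᴴ * (D.Qᴴ * B * D.Q - D.R * Z * D.Rᴴ)) := by
  set G := B - D.Q * (D.Qᴴ * B * D.Q) * D.Qᴴ with hG
  set V := D.Qᴴ * B * D.Q - D.R * Z * D.Rᴴ with hV
  have e : B - A * Z * Aᴴ = G + D.Q * V * D.Qᴴ := by
    have h1 : A * Z * Aᴴ = D.Q * (D.R * Z * D.Rᴴ) * D.Qᴴ := by
      rw [← D.conjTranspose_eq]
      conv_lhs => enter [1, 1]; rw [show A = D.Q * D.R from D.eq.symm]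
      simp only [Matrix.mul_assoc]
    rw [h1, hG, hV, Matrix.mul_sub, Matrix.sub_mul]
    abel
  have hQG : D.Qᴴ * G * D.Q = 0 := by
    rw [hG, Matrix.mul_sub, Matrix.sub_mul]
    simp only [Matrix.mul_assoc, D.QQ_mul, D.QQ, Matrix.mul_one, sub_self]
  have hQG' : D.Qᴴ * Gᴴ * D.Q = 0 := by
    have := congrArg conjTranspose hQG
    simpa [Matrix.mul_assoc] using this
  have t1 : trace (Gᴴ * (D.Q * V * D.Qᴴ)) = 0 := by
    rw [← Matrix.mul_assoc, trace_mul_comm, ← Matrix.mul_assoc, ← Matrix.mul_assoc, hQG',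
      Matrix.zero_mul, trace_zero]
  have t2 : trace ((D.Q * V * D.Qᴴ)ᴴ * G) = 0 := by
    have : (D.Q * V * D.Qᴴ)ᴴ * G = D.Q * (Vᴴ * (D.Qᴴ * G)) := by
      simp [Matrix.mul_assoc]
    rw [this, trace_mul_comm, Matrix.mul_assoc, hQG, Matrix.mul_zero, trace_zero]
  have t3 : trace ((D.Q * V * D.Qᴴ)ᴴ * (D.Q * V * D.Qᴴ)) = trace (Vᴴ * V) := by
    have : (D.Q * V * D.Qᴴ)ᴴ * (D.Q * V * D.Qᴴ) = D.Q * (Vᴴ * (V * D.Qᴴ)) := by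
      simp [Matrix.mul_assoc, D.QQ_mul]
    rw [this, trace_mul_comm, Matrix.mul_assoc, Matrix.mul_assoc, D.QQ, Matrix.mul_one]
  rw [e, conjTranspose_add, Matrix.add_mul, Matrix.mul_add, Matrix.mul_add, trace_add, trace_add,
    trace_add, t1, t2, t3]
  ring

/-- The map `X ↦ R X Rᴴ` is onto. -/
theorem RankFactorization.R_mul_S_mul (D : RankFactorization A)
    (W : Matrix (Fin D.r) (Fin D.r) ℂ) : D.R * (D.S * W * D.Sᴴ) * D.Rᴴ = W := by
  have h : D.Sᴴ * D.Rᴴ = 1 := by rw [← conjTranspose_mul, D.RS, conjTranspose_one]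
  rw [← Matrix.mul_assoc, D.RS_mul, Matrix.mul_assoc, h, Matrix.mul_one]

/-- The normal equation for Hermitian least-squares solutions. -/
theorem mem_leastSquares_iff (D : RankFactorization A) (hB : B.IsHermitian)
    {X : Matrix (Fin n) (Fin n) ℂ} :
    X ∈ leastSquares A B ↔ X.IsHermitian ∧ D.R * X * D.Rᴴ = D.Qᴴ * B * D.Q := by
  have hle : ∀ Z Z' : Matrix (Fin n) (Fin n) ℂ,
      frobNorm (B - A * Z * Aᴴ) ≤ frobNorm (B - A * Z' * Aᴴ) ↔
      (trace ((D.Qᴴ * B * D.Q - D.R * Z * D.Rᴴ)ᴴ * (D.Qᴴ * B * D.Q - D.R * Z * D.Rᴴ))).re ≤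
      (trace ((D.Qᴴ * B * D.Q - D.R * Z' * D.Rᴴ)ᴴ * (D.Qᴴ * B * D.Q - D.R * Z' * D.Rᴴ))).re := by
    intro Z Z'
    have hn : ∀ C : Matrix (Fin m) (Fin m) ℂ, 0 ≤ frobNorm C := fun C => by
      rw [frobNorm, frobenius_norm_def]; positivity
    rw [← sq_le_sq₀ (hn _) (hn _), frobNorm_sq, frobNorm_sq, D.trace_residual, D.trace_residual,
      Complex.add_re, Complex.add_re, add_le_add_iff_left]
  refine and_congr_right fun hX => ⟨fun h => ?_, fun h Z _ => ?_⟩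
  · have h0 := (hle _ _).1 (h (D.S * (D.Qᴴ * B * D.Q) * D.Sᴴ)
      (isHermitian_mul_mul_conjTranspose _ (isHermitian_conjTranspose_mul_mul _ hB)))
    rw [D.R_mul_S_mul, sub_self, Matrix.mul_zero, trace_zero, Complex.zero_re] at h0
    have hp := posSemidef_conjTranspose_mul_self (D.Qᴴ * B * D.Q - D.R * X * D.Rᴴ)
    have h1 := Complex.nonneg_iff.1 hp.trace_nonneg
    have h2 : trace ((D.Qᴴ * B * D.Q - D.R * X * D.Rᴴ)ᴴ * (D.Qᴴ * B * D.Q - D.R * X * D.Rᴴ)) = 0 :=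
      Complex.ext (le_antisymm h0 h1.1) h1.2.symm
    have h3 := conjTranspose_mul_self_eq_zero.1 (hp.trace_eq_zero_iff.1 h2)
    exact (sub_eq_zero.1 h3).symm
  · rw [hle, h, sub_self, Matrix.mul_zero, trace_zero, Complex.zero_re]
    exact trace_conjTranspose_mul_self_re_nonneg _

variable (D : RankFactorization A)

/-- The inertia of the residual, from the generalized Schur complement in the basis `[Q F]`. -/
theorem RankFactorization.inertia_sub (hB : B.IsHermitian) {Y : Matrix (Fin n) (Fin n) ℂ}
    (hY : Y.IsHermitian) (N : PseudoInverse (D.Fᴴ * B * D.F))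
    (D' : RankFactorization (D.Qᴴ * B * D.F * N.proj)) :
    inertia (B - A * Y * Aᴴ) = inertia (D.Fᴴ * B * D.F) + ((D'.r : ℤ), (D'.r : ℤ)) +
      inertia (D'.Fᴴ * (D.Qᴴ * B * D.Q - D.R * Y * D.Rᴴ -
        D.Qᴴ * B * D.F * N.inv * (D.Qᴴ * B * D.F)ᴴ) * D'.F) := by
  rw [← N.inertia_fromBlocks (isHermitian_conjTranspose_mul_mul _ hB)
    ((isHermitian_conjTranspose_mul_mul _ hB).sub (isHermitian_mul_mul_conjTranspose _ hY)),
    ← inertia_congr (hB.sub (isHermitian_mul_mul_conjTranspose _ hY)) (fromCols D.Q D.F)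
      (fromRows D.Qᴴ D.Fᴴ) D.fromCols_mul_fromRows_eq_one]
  congr 1
  have h1 : D.Qᴴ * A = D.R :=
    calc D.Qᴴ * A = D.Qᴴ * (D.Q * D.R) := congrArg (D.Qᴴ * ·) D.eq.symm
      _ = D.R := D.QQ_mul _
  have h2 : Aᴴ * D.Q = D.Rᴴ := by rw [← h1]; simp
  have h3 : Aᴴ * D.F = 0 := by
    have := congrArg conjTranspose D.F_mul
    simpa using this
  rw [conjTranspose_fromCols_eq_fromRows_conjTranspose, fromRows_mul, fromRows_mul_fromCols]
  simp only [Matrix.mul_sub, Matrix.sub_mul, conjTranspose_mul, hB.eq, conjTranspose_conjTranspose,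
    Matrix.mul_assoc, h2, h3, Matrix.mul_zero, sub_zero, ← Matrix.mul_assoc _ A, h1, D.F_mul,
    Matrix.zero_mul]

/-- The least-rank solutions: by `RankFactorization.inertia_sub` the rank of the residual is a constant
plus the rank of the matrix on the right, which the choice of `Y` can make zero. -/
theorem mem_leastRank_iff (hB : B.IsHermitian) (N : PseudoInverse (D.Fᴴ * B * D.F))
    (D' : RankFactorization (D.Qᴴ * B * D.F * N.proj)) {Y : Matrix (Fin n) (Fin n) ℂ} :
    Y ∈ leastRank A B ↔ Y.IsHermitian ∧ D'.Fᴴ * (D.Qᴴ * B * D.Q - D.R * Y * D.Rᴴ -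
        D.Qᴴ * B * D.F * N.inv * (D.Qᴴ * B * D.F)ᴴ) * D'.F = 0 := by
  have hK : ∀ {Z : Matrix (Fin n) (Fin n) ℂ}, Z.IsHermitian →
      (D'.Fᴴ * (D.Qᴴ * B * D.Q - D.R * Z * D.Rᴴ -
        D.Qᴴ * B * D.F * N.inv * (D.Qᴴ * B * D.F)ᴴ) * D'.F).IsHermitian := fun hZ =>
    isHermitian_conjTranspose_mul_mul _
      (((isHermitian_conjTranspose_mul_mul _ hB).sub (isHermitian_mul_mul_conjTranspose _ hZ)).sub
        (isHermitian_mul_mul_conjTranspose _ N.herm))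
  have hr : ∀ {Z : Matrix (Fin n) (Fin n) ℂ}, Z.IsHermitian →
      rk (B - A * Z * Aᴴ) = rk (D.Fᴴ * B * D.F) + 2 * D'.r +
        rk (D'.Fᴴ * (D.Qᴴ * B * D.Q - D.R * Z * D.Rᴴ -
        D.Qᴴ * B * D.F * N.inv * (D.Qᴴ * B * D.F)ᴴ) * D'.F) := by
    intro Z hZ
    have h := D.inertia_sub hB hZ N D'
    have h1 := congrArg Prod.fst h
    have h2 := congrArg Prod.snd h
    simp only [inertia, Prod.fst_add, Prod.snd_add] at h1 h2
    rw [rk_eq_iPos_add_iNeg (hB.sub (isHermitian_mul_mul_conjTranspose _ hZ)),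
      rk_eq_iPos_add_iNeg (hK hZ), rk_eq_iPos_add_iNeg (isHermitian_conjTranspose_mul_mul _ hB),
      h1, h2]
    ring
  refine and_congr_right fun hY => ⟨fun h => ?_, fun h Z hZ => ?_⟩
  · have hZ : (D.S * (D.Qᴴ * B * D.Q - D.Qᴴ * B * D.F * N.inv * (D.Qᴴ * B * D.F)ᴴ) *
        D.Sᴴ).IsHermitian := isHermitian_mul_mul_conjTranspose _
      ((isHermitian_conjTranspose_mul_mul _ hB).sub (isHermitian_mul_mul_conjTranspose _ N.herm))
    have h1 : rk (B - A * Y * Aᴴ) ≤ _ := Nat.cast_le.2 (h _ hZ)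
    have h2 := hr hZ
    rw [D.R_mul_S_mul, sub_sub_cancel, sub_self, Matrix.mul_zero, Matrix.zero_mul,
      rk_eq_zero_iff.2 rfl] at h2
    rw [← rk] at h1
    rw [h2, hr hY] at h1
    exact rk_eq_zero_iff.1 (le_antisymm (by linarith) (rk_nonneg _))
  · have h1 := hr hY
    have h2 := hr hZ
    rw [h, rk_eq_zero_iff.2 rfl] at h1
    have h3 := rk_nonneg (D'.Fᴴ * (D.Qᴴ * B * D.Q - D.R * Z * D.Rᴴ -
        D.Qᴴ * B * D.F * N.inv * (D.Qᴴ * B * D.F)ᴴ) * D'.F)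
    have : rk (B - A * Y * Aᴴ) ≤ rk (B - A * Z * Aᴴ) := by linarith
    exact Nat.cast_le.1 this

end

/-! ### The matrices `M` and `N` and the set of differences -/

section

variable {k l p q : Type} [Fintype k] [DecidableEq k] [Fintype l] [DecidableEq l]
  [Fintype p] [DecidableEq p] [Fintype q] [DecidableEq q]

theorem conjTranspose_submatrix_mul_mul (X : Matrix k k ℂ) (P : Matrix k l ℂ) (e : p → l) :
    (P.submatrix id e)ᴴ * X * P.submatrix id e = (Pᴴ * X * P).submatrix e e := by
  rw [conjTranspose_submatrix, submatrix_mul _ _ _ _ _ Function.bijective_id,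
    submatrix_mul _ _ _ _ _ Function.bijective_id, submatrix_id_id]

/-- The rank factorization of a matrix followed by `n` zero rows, whose coordinates join the complement
of the column space. -/
def RankFactorization.appendZero {C : Matrix k l ℂ} (D : RankFactorization C) (n : ℕ) :
    RankFactorization (fromRows C (0 : Matrix (Fin n) l ℂ)) where
  r := D.r
  t := D.t + n
  Q := fromRows D.Q 0
  F := (fromBlocks D.F 0 0 1).submatrix id finSumFinEquiv.symm
  R := D.R
  S := D.S
  QQ := by
    simp [conjTranspose_fromRows_eq_fromCols_conjTranspose, fromCols_mul_fromRows, D.QQ]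
  FF := by
    rw [conjTranspose_submatrix, ← submatrix_mul _ _ _ _ _ Function.bijective_id,
      fromBlocks_conjTranspose, fromBlocks_multiply]
    simp [D.FF]
  QF := by
    rw [conjTranspose_fromRows_eq_fromCols_conjTranspose,
      ← submatrix_id_id (fromCols D.Qᴴ (0 : Matrix (Fin n) (Fin D.r) ℂ)ᴴ),
      ← submatrix_mul _ _ _ _ _ Function.bijective_id, fromCols_mul_fromBlocks]
    ext i j
    simp only [submatrix_apply, id]
    rcases finSumFinEquiv.symm j with j | j <;> simp [D.QF]
  compl := by
    rw [conjTranspose_submatrix, submatrix_mul_equiv, submatrix_id_id,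
      conjTranspose_fromRows_eq_fromCols_conjTranspose, fromRows_mul_fromCols,
      fromBlocks_conjTranspose, fromBlocks_multiply, fromBlocks_add]
    simp [D.compl]
  eq := by simp [fromRows_mul, D.eq]
  RS := D.RS

end

section

variable {m n : ℕ} {A : Matrix (Fin m) (Fin n) ℂ} {B : Matrix (Fin m) (Fin m) ℂ}
  (D : RankFactorization A)

theorem RankFactorization.inertia_blockM (hB : B.IsHermitian) :
    inertia (blockM A B) = ((D.r : ℤ), (D.r : ℤ)) + inertia (D.Fᴴ * B * D.F) :=
  D.inertia_fromBlocks_zero hB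

/-- After regrouping the index set, the column `A` of `N` is split off, and the generalized Schur
complement applies to what is left, with `0` in the place of `K`. This replaces `G` by `-G` and
interchanges the two inertia indices. -/
theorem RankFactorization.inertia_blockN (hB : B.IsHermitian)
    (N : PseudoInverse (D.Fᴴ * B * D.F)) (D' : RankFactorization (D.Qᴴ * B * D.F * N.proj)) :
    inertia (blockN A B) = ((D.r : ℤ), (D.r : ℤ)) + (inertia (D.Fᴴ * B * D.F) +
      ((D'.r : ℤ), (D'.r : ℤ)) + (inertia (D'.Fᴴ *
        (D.Qᴴ * B * D.F * N.inv * (D.Qᴴ * B * D.F)ᴴ) * D'.F)).swap) := by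
  have hE : (D.Fᴴ * B * D.F).IsHermitian := isHermitian_conjTranspose_mul_mul _ hB
  have h0 : ∀ {l : ℕ}, (0 : Matrix (Fin l) (Fin l) ℂ).IsHermitian := isHermitian_zero
  have hG : (D.Qᴴ * B * D.F * N.inv * (D.Qᴴ * B * D.F)ᴴ).IsHermitian :=
    isHermitian_mul_mul_conjTranspose _ N.herm
  have h1 : inertia (blockN A B) = inertia (fromBlocks (fromBlocks B (B * A) (B * A)ᴴ 0)
      (fromRows A 0) (fromRows A (0 : Matrix (Fin n) (Fin n) ℂ))ᴴ 0) := by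
    rw [← inertia_reindex (Equiv.sumAssoc (Fin m) (Fin n) (Fin n)).symm (blockN A B)]
    congr 1
    ext ((i | i) | i) ((j | j) | j) <;> simp [blockN, hB.eq]
  rw [h1, (D.appendZero n).inertia_fromBlocks_zero (isHermitian_fromBlocks hB h0 _)]
  congr 1
  have e1 : D.Fᴴ * (B * (D.Q * D.R)) = D.Fᴴ * (B * A) := by rw [D.eq]
  have h2 : (fromBlocks D.F 0 0 1 : Matrix (Fin m ⊕ Fin n) (Fin D.t ⊕ Fin n) ℂ)ᴴ *
      fromBlocks B (B * A) (B * A)ᴴ 0 *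
      (fromBlocks D.F 0 0 1 : Matrix (Fin m ⊕ Fin n) (Fin D.t ⊕ Fin n) ℂ) =
      fromBlocks (D.Fᴴ * B * D.F) (D.Fᴴ * B * D.Q * D.R) (D.Fᴴ * B * D.Q * D.R)ᴴ
        (D.Rᴴ * (0 : Matrix (Fin D.r) (Fin D.r) ℂ) * D.R) := by
    rw [fromBlocks_conjTranspose, fromBlocks_multiply, fromBlocks_multiply]
    simp [Matrix.mul_assoc, hB.eq, e1]
  refine (congrArg inertia ((conjTranspose_submatrix_mul_mul _ _ finSumFinEquiv.symm).trans
    (congrArg (fun X => X.submatrix finSumFinEquiv.symm finSumFinEquiv.symm) h2))).trans ?_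
  refine (inertia_reindex finSumFinEquiv _).trans ?_
  rw [inertia_fromBlocks_mul_right hE h0 _ D.RS]
  have h3 := N.inertia_fromBlocks hE h0 (D.Qᴴ * B * D.F) D'
  have e3 : D.Fᴴ * B * D.Q = (D.Qᴴ * B * D.F)ᴴ := by simp [Matrix.mul_assoc, hB.eq]
  rw [zero_sub, Matrix.mul_neg, Matrix.neg_mul,
    inertia_neg (isHermitian_conjTranspose_mul_mul _ hG)] at h3
  rw [← h3, ← inertia_fromBlocks_swap, e3, conjTranspose_conjTranspose]

theorem RankFactorization.rk_fromCols_self (hB : B.IsHermitian)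
    (N : PseudoInverse (D.Fᴴ * B * D.F)) (D' : RankFactorization (D.Qᴴ * B * D.F * N.proj)) :
    rk (fromCols A B) = D.r + (rk (D.Fᴴ * B * D.F) + D'.r) := by
  rw [D.rk_fromCols, ← N.rk_fromRows _ D', ← rk_conjTranspose (D.Fᴴ * B),
    ← rk_mul_mul _ D.fromCols_mul_fromRows_eq_one (Matrix.one_mul 1)]
  congr 2
  simp [fromRows_mul, hB.eq, Matrix.mul_assoc]

/-- Splitting off both columns `B A` and `A` of `N` at once leaves a compression of `B`, which has no
negative eigenvalues. -/
theorem iNeg_blockN_of_posSemidef (hB : B.PosSemidef) :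
    iNeg (blockN A B) = rk (fromCols A (B * A)) := by
  obtain ⟨D⟩ := nonempty_rankFactorization (fromCols (B * A) A)
  have h := congrArg Prod.snd (D.inertia_fromBlocks_zero hB.1)
  have e : fromBlocks B (fromCols (B * A) A) (fromCols (B * A) A)ᴴ 0 = blockN A B := by
    simp [blockN, conjTranspose_fromCols_eq_fromRows_conjTranspose, hB.1.eq]
  have h1 : iNeg (D.Fᴴ * B * D.F) = 0 :=
    (posSemidef_iff_iNeg (isHermitian_conjTranspose_mul_mul _ hB.1)).1
      (hB.conjTranspose_mul_mul_same _)
  rw [e] at h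
  simp only [inertia, Prod.snd_add, h1, add_zero] at h
  rw [h, ← D.rk_eq, rk, rk]
  congr 1
  rw [← rank_submatrix (fromCols A (B * A)) (Equiv.refl _) (Equiv.sumComm (Fin n) (Fin n))]
  congr 1
  ext i (j | j) <;> rfl

/-- The differences `X - Y` are exactly the Hermitian matrices with a prescribed compression `G`, and
the inertia of `M` and `N` and the rank of `[A, B]` are expressed by that of `G`. Here `ep` and `en`
are the inertia indices of `Fᴴ B F`, and `c` is the rank of `Qᴴ B F` on the kernel of that matrix. -/
theorem exists_compression (A : Matrix (Fin m) (Fin n) ℂ) (hB : B.IsHermitian) :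
    ∃ (g : ℕ) (T : Matrix (Fin g) (Fin n) ℂ) (T' : Matrix (Fin n) (Fin g) ℂ)
      (G : Matrix (Fin g) (Fin g) ℂ) (ep en c : ℤ), T * T' = 1 ∧ G.IsHermitian ∧
      rk A = c + g ∧
      iPos (blockM A B) = rk A + ep ∧ iNeg (blockM A B) = rk A + en ∧
      iPos (blockN A B) = rk A + ep + c + iNeg G ∧
      iNeg (blockN A B) = rk A + en + c + iPos G ∧
      rk (fromCols A B) = rk A + ep + en + c ∧
      (∀ Δ, (∃ X ∈ leastSquares A B, ∃ Y ∈ leastRank A B, Δ = X - Y) ↔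
        Δ.IsHermitian ∧ T * Δ * Tᴴ = G) ∧
      (B.PosSemidef → en = 0 ∧ c = 0 ∧ iNeg G = 0) := by
  obtain ⟨D⟩ := nonempty_rankFactorization A
  have hE : (D.Fᴴ * B * D.F).IsHermitian := isHermitian_conjTranspose_mul_mul _ hB
  obtain ⟨N⟩ := nonempty_pseudoInverse hE
  obtain ⟨D'⟩ := nonempty_rankFactorization (D.Qᴴ * B * D.F * N.proj)
  have hΦ : (D.Qᴴ * B * D.F * N.inv * (D.Qᴴ * B * D.F)ᴴ).IsHermitian := isHermitian_mul_mul_conjTranspose _ N.herm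
  have hM := D.inertia_blockM hB
  have hN := D.inertia_blockN hB N D'
  have hrE := rk_eq_iPos_add_iNeg hE
  refine ⟨D'.t, D'.Fᴴ * D.R, D.S * D'.F, D'.Fᴴ * (D.Qᴴ * B * D.F * N.inv * (D.Qᴴ * B * D.F)ᴴ) * D'.F,
    iPos (D.Fᴴ * B * D.F), iNeg (D.Fᴴ * B * D.F), D'.r, ?_, ?_, ?_, ?_, ?_, ?_, ?_, ?_, ?_, ?_⟩
  · rw [Matrix.mul_assoc D'.Fᴴ, D.RS_mul, D'.FF]
  · exact isHermitian_conjTranspose_mul_mul _ hΦ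
  · have := D'.r_add_t
    rw [Fintype.card_fin] at this
    rw [D.rk_eq]
    exact_mod_cast this.symm
  · rw [D.rk_eq]; exact congrArg Prod.fst hM
  · rw [D.rk_eq]; exact congrArg Prod.snd hM
  · rw [D.rk_eq]
    have := congrArg Prod.fst hN
    simp only [inertia, Prod.fst_add, Prod.fst_swap] at this
    rw [this]; ring
  · rw [D.rk_eq]
    have := congrArg Prod.snd hN
    simp only [inertia, Prod.snd_add, Prod.snd_swap] at this
    rw [this]; ring
  · rw [D.rk_fromCols_self hB N D', D.rk_eq, hrE]; ring
  · intro Δ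
    have hT : ∀ Z : Matrix (Fin n) (Fin n) ℂ, D'.Fᴴ * D.R * Z * (D'.Fᴴ * D.R)ᴴ =
        D'.Fᴴ * (D.R * Z * D.Rᴴ) * D'.F := fun Z => by simp [Matrix.mul_assoc]
    rw [hT]
    constructor
    · rintro ⟨X, hX, Y, hY, rfl⟩
      rw [mem_leastSquares_iff D hB] at hX
      rw [mem_leastRank_iff D hB N D'] at hY
      refine ⟨hX.1.sub hY.1, ?_⟩
      rw [Matrix.mul_sub, Matrix.sub_mul, hX.2]
      have h := hY.2
      rw [Matrix.mul_sub, Matrix.sub_mul] at h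
      exact sub_eq_zero.1 h
    · rintro ⟨hΔ, h⟩
      have hX : (D.S * (D.Qᴴ * B * D.Q) * D.Sᴴ).IsHermitian :=
        isHermitian_mul_mul_conjTranspose _ (isHermitian_conjTranspose_mul_mul _ hB)
      refine ⟨D.S * (D.Qᴴ * B * D.Q) * D.Sᴴ, ?_, D.S * (D.Qᴴ * B * D.Q) * D.Sᴴ - Δ, ?_,
        (sub_sub_cancel _ _).symm⟩
      · rw [mem_leastSquares_iff D hB]
        exact ⟨hX, D.R_mul_S_mul _⟩
      · rw [mem_leastRank_iff D hB N D']
        refine ⟨hX.sub hΔ, ?_⟩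
        rw [Matrix.mul_sub D.R, Matrix.sub_mul _ _ D.Rᴴ, D.R_mul_S_mul, sub_sub_cancel,
          Matrix.mul_sub, Matrix.sub_mul, h, sub_self]
  · intro hB'
    have hE' : (D.Fᴴ * B * D.F).PosSemidef := hB'.conjTranspose_mul_mul_same _
    have hen := (posSemidef_iff_iNeg hE).1 hE'
    refine ⟨hen, ?_, ?_⟩
    · have h := congrArg Prod.snd (D.inertia_sub hB (isHermitian_zero (n := Fin n)) N D')
      rw [Matrix.mul_zero, Matrix.zero_mul, sub_zero] at h
      simp only [inertia, Prod.snd_add, hen, (posSemidef_iff_iNeg hB).1 hB'] at h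
      have h1 := iNeg_nonneg (D'.Fᴴ * (D.Qᴴ * B * D.Q - D.R * (0 : Matrix (Fin n) (Fin n) ℂ) * D.Rᴴ - D.Qᴴ * B * D.F * N.inv * (D.Qᴴ * B * D.F)ᴴ) * D'.F)
      have h2 : (0 : ℤ) ≤ D'.r := Int.natCast_nonneg _
      linarith
    · exact (posSemidef_iff_iNeg (isHermitian_conjTranspose_mul_mul _ hΦ)).1
        (((N.inv_posSemidef hE').mul_mul_conjTranspose_same _).conjTranspose_mul_mul_same _)

end

/-! ### Extreme bordered matrices -/

section

variable {k l : Type} [Fintype k] [DecidableEq k] [Fintype l] [DecidableEq l]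

theorem inertia_le_inertia_fromBlocks {G : Matrix k k ℂ} {W : Matrix l l ℂ} (hG : G.IsHermitian)
    (hW : W.IsHermitian) (Z : Matrix k l ℂ) : inertia G ≤ inertia (fromBlocks G Z Zᴴ W) := by
  refine le_of_eq_of_le (congrArg inertia ?_) (inertia_conjTranspose_mul_mul_le
    (isHermitian_fromBlocks hG hW Z) (fromRows 1 0 : Matrix (k ⊕ l) k ℂ))
  rw [conjTranspose_fromRows_eq_fromCols_conjTranspose, fromCols_mul_fromBlocks,
    fromCols_mul_fromRows]
  simp

/-- The bordered matrix is a compression of the direct sum of `G` and the hyperbolic form on `l ⊕ l`. -/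
theorem inertia_fromBlocks_le {G : Matrix k k ℂ} {W : Matrix l l ℂ} (hG : G.IsHermitian)
    (hW : W.IsHermitian) (Z : Matrix k l ℂ) : inertia (fromBlocks G Z Zᴴ W) ≤
      inertia G + ((Fintype.card l : ℤ), (Fintype.card l : ℤ)) := by
  rw [← inertia_hyperbolic, ← inertia_fromBlocks_diag]
  have h0 : (fromBlocks 0 1 1 0 : Matrix (l ⊕ l) (l ⊕ l) ℂ).IsHermitian := by
    simpa using isHermitian_fromBlocks (isHermitian_zero (α := ℂ) (n := l))
      (isHermitian_zero (α := ℂ) (n := l)) 1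
  have h1 : (fromBlocks G 0 0 (fromBlocks 0 1 1 0) :
      Matrix (k ⊕ (l ⊕ l)) (k ⊕ (l ⊕ l)) ℂ).IsHermitian := by
    simpa using isHermitian_fromBlocks hG h0 0
  refine le_of_eq_of_le (congrArg inertia ?_) (inertia_conjTranspose_mul_mul_le h1
    (fromBlocks 1 0 (fromRows 0 Zᴴ) (fromRows 1 ((1/2 : ℂ) • W)) :
      Matrix (k ⊕ (l ⊕ l)) (k ⊕ l) ℂ))
  rw [fromBlocks_conjTranspose, fromBlocks_multiply, fromBlocks_multiply]
  simp [conjTranspose_fromRows_eq_fromCols_conjTranspose, fromCols_mul_fromBlocks,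
    fromCols_mul_fromRows, hW.eq, ← add_smul]
  norm_num

/-- Some bordering of `G` by `f` rows and columns has the largest conceivable rank: `Z = X Yᴴ` is a
partial isometry from the new coordinates to `ker G`, of the largest possible rank, and
`W = 1 - Y Yᴴ` is the projection onto the kernel of `Z`. -/
theorem exists_bordering_rk {g f : ℕ} {G : Matrix (Fin g) (Fin g) ℂ} (hG : G.IsHermitian) :
    ∃ (Z : Matrix (Fin g) (Fin f) ℂ) (W : Matrix (Fin f) (Fin f) ℂ), W.IsHermitian ∧
      min ((g : ℤ) + f) (rk G + 2 * f) ≤ rk (fromBlocks G Z Zᴴ W) := by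
  obtain ⟨D⟩ := nonempty_rankFactorization G
  let a : Fin (min D.t f) → Fin D.t := Fin.castLE (min_le_left _ _)
  let b : Fin (min D.t f) → Fin f := Fin.castLE (min_le_right _ _)
  let X := D.F.submatrix id a
  let Y := (1 : Matrix (Fin f) (Fin f) ℂ).submatrix id b
  have hX : Xᴴ * X = 1 := by
    have h := conjTranspose_submatrix_mul_mul 1 D.F a
    rw [Matrix.mul_one, Matrix.mul_one, D.FF, submatrix_one _ (Fin.castLE_injective _)] at h
    exact h
  have hY : Yᴴ * Y = 1 := by
    have h := conjTranspose_submatrix_mul_mul 1 (1 : Matrix (Fin f) (Fin f) ℂ) b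
    rw [Matrix.mul_one, Matrix.mul_one, Matrix.mul_one, conjTranspose_one,
      submatrix_one _ (Fin.castLE_injective _)] at h
    exact h
  have hGX : G * X = 0 := by
    have h : G * D.F = 0 := by
      have := congrArg conjTranspose D.F_mul
      simpa [hG.eq] using this
    have h2 : G * X = (G * D.F).submatrix id a := by
      rw [submatrix_mul _ _ _ _ _ Function.bijective_id, submatrix_id_id]
    rw [h2, h]; rfl
  have hXG : Xᴴ * G = 0 := by
    have := congrArg conjTranspose hGX
    simpa [hG.eq] using this
  have hXm : ∀ V : Matrix (Fin (min D.t f)) (Fin f) ℂ, Xᴴ * (X * V) = V := fun V => by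
    rw [← Matrix.mul_assoc, hX, Matrix.one_mul]
  have hYm : ∀ V : Matrix (Fin (min D.t f)) (Fin f) ℂ, Yᴴ * (Y * V) = V := fun V => by
    rw [← Matrix.mul_assoc, hY, Matrix.one_mul]
  have hW : (1 - Y * Yᴴ).IsHermitian := isHermitian_one.sub (isHermitian_mul_conjTranspose_self Y)
  refine ⟨X * Yᴴ, 1 - Y * Yᴴ, hW, ?_⟩
  -- the bordered matrix compresses to the direct sum of `G` and the involution `K`
  let K : Matrix (Fin (min D.t f) ⊕ Fin f) (Fin (min D.t f) ⊕ Fin f) ℂ :=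
    fromBlocks 0 Yᴴ Y (1 - Y * Yᴴ)
  have hK : K * K = 1 := by
    rw [fromBlocks_multiply, ← fromBlocks_one]
    congr 1
    · simp [hY]
    · simp [Matrix.mul_sub, hYm]
    · simp [Matrix.sub_mul, Matrix.mul_assoc, hY]
    · simp [Matrix.sub_mul, Matrix.mul_sub, Matrix.mul_assoc, hYm]
  have hrK : rk K = min D.t f + f := by
    rw [isUnit_iff_rk.1 ⟨⟨K, K, hK, hK⟩, rfl⟩]
    simp
  let P : Matrix (Fin g ⊕ Fin f) (Fin g ⊕ (Fin (min D.t f) ⊕ Fin f)) ℂ :=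
    fromBlocks (1 - X * Xᴴ) (fromCols X 0) 0 (fromCols 0 1)
  have hHP : fromBlocks G (X * Yᴴ) (X * Yᴴ)ᴴ (1 - Y * Yᴴ) * P =
      fromBlocks G (fromCols 0 (X * Yᴴ)) 0 (fromCols Y (1 - Y * Yᴴ)) := by
    rw [fromBlocks_multiply]
    simp only [mul_fromCols, fromCols_add_fromCols, Matrix.mul_sub, Matrix.mul_zero, add_zero,
      zero_add, ← Matrix.mul_assoc, hGX, Matrix.zero_mul, Matrix.mul_one, sub_zero,
      conjTranspose_mul, conjTranspose_conjTranspose]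
    simp only [Matrix.mul_assoc, hX, Matrix.mul_one]
    congr 1
    exact sub_self _
  have key : fromBlocks G 0 0 K =
      Pᴴ * (fromBlocks G (X * Yᴴ) (X * Yᴴ)ᴴ (1 - Y * Yᴴ) * P) := by
    rw [hHP, fromBlocks_conjTranspose, fromBlocks_multiply]
    simp only [conjTranspose_fromCols_eq_fromRows_conjTranspose, mul_fromCols, fromRows_mul,
      fromCols_add_fromCols, fromRows_add_fromRows]
    simp [Matrix.sub_mul, Matrix.mul_assoc, hXG, hXm]
    rfl
  have h1 : rk (fromBlocks G 0 0 K) ≤ rk (fromBlocks G (X * Yᴴ) (X * Yᴴ)ᴴ (1 - Y * Yᴴ)) := by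
    rw [key]
    exact (rk_mul_le_right _ _).trans (rk_mul_le_left _ _)
  rw [rk_fromBlocks_diag, hrK] at h1
  refine le_trans ?_ h1
  have h2 := D.rk_eq
  have h3 := D.r_add_t
  rw [Fintype.card_fin] at h3
  rw [h2]
  omega

/-- A right invertible `T` extends to a basis: the columns of `Tᴴ`, followed by those of some `F`, form an
invertible matrix. -/
theorem exists_frame {g n : ℕ} {T : Matrix (Fin g) (Fin n) ℂ} {T' : Matrix (Fin n) (Fin g) ℂ}
    (hT : T * T' = 1) : ∃ (f : ℕ) (F : Matrix (Fin n) (Fin f) ℂ)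
      (U' : Matrix (Fin g ⊕ Fin f) (Fin n) ℂ), g + f = n ∧ fromCols Tᴴ F * U' = 1 ∧
      U' * fromCols Tᴴ F = 1 := by
  obtain ⟨D⟩ := nonempty_rankFactorization Tᴴ
  have hr : rk Tᴴ = g := by
    apply le_antisymm
    · exact Nat.cast_le.2 (rank_le_width Tᴴ)
    · have h := rk_mul_le_right T'ᴴ Tᴴ
      rwa [← conjTranspose_mul, hT, conjTranspose_one, rk_one, Fintype.card_fin] at h
  have hg : D.r = g := by rw [D.rk_eq] at hr; exact_mod_cast hr
  have hn := D.r_add_t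
  rw [Fintype.card_fin, hg] at hn
  have h1 : fromCols Tᴴ D.F * fromRows (D.S * D.Qᴴ) D.Fᴴ = 1 := by
    rw [fromCols_mul_fromRows, ← Matrix.mul_assoc, D.mul_S, D.compl]
  exact ⟨D.t, D.F, _, hn, h1, (mul_eq_one_comm_of_card_eq _ _ _ (by simp [hn])).1 h1⟩

end

/-! ### Extrema under a fixed compression -/

/-- Bounds for the inertia of a Hermitian matrix with the prescribed compression `G` to a subspace of
codimension `f`, and matrices attaining them. -/
theorem inertia_of_compression {g n : ℕ} {T : Matrix (Fin g) (Fin n) ℂ}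
    {T' : Matrix (Fin n) (Fin g) ℂ} (hT : T * T' = 1) {G : Matrix (Fin g) (Fin g) ℂ}
    (hG : G.IsHermitian) : ∃ f : ℕ, g + f = n ∧
      (∀ Δ : Matrix (Fin n) (Fin n) ℂ, Δ.IsHermitian → T * Δ * Tᴴ = G →
        inertia G ≤ inertia Δ ∧ inertia Δ ≤ inertia G + ((f : ℤ), (f : ℤ))) ∧
      (∃ Δ : Matrix (Fin n) (Fin n) ℂ, (Δ.IsHermitian ∧ T * Δ * Tᴴ = G) ∧
        inertia Δ = inertia G) ∧
      (∃ Δ : Matrix (Fin n) (Fin n) ℂ, (Δ.IsHermitian ∧ T * Δ * Tᴴ = G) ∧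
        iPos Δ = iPos G + f) ∧
      (∃ Δ : Matrix (Fin n) (Fin n) ℂ, (Δ.IsHermitian ∧ T * Δ * Tᴴ = G) ∧
        iNeg Δ = iNeg G + f) ∧
      (∃ Δ : Matrix (Fin n) (Fin n) ℂ, (Δ.IsHermitian ∧ T * Δ * Tᴴ = G) ∧
        min (n : ℤ) (rk G + 2 * f) ≤ rk Δ) := by
  obtain ⟨f, F, U', hn, hU, hU'⟩ := exists_frame hT
  set U := fromCols Tᴴ F with hUdef
  have hblock : ∀ Δ : Matrix (Fin n) (Fin n) ℂ, Δ.IsHermitian →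
      Uᴴ * Δ * U = fromBlocks (T * Δ * Tᴴ) (T * Δ * F) (T * Δ * F)ᴴ (Fᴴ * Δ * F) := by
    intro Δ hΔ
    rw [hUdef, conjTranspose_fromCols_eq_fromRows_conjTranspose, fromRows_mul,
      fromRows_mul_fromCols]
    simp [hΔ.eq, Matrix.mul_assoc]
  -- every bordering of `G` is the matrix of some admissible `Δ` in the frame `U`
  have hex : ∀ (Z : Matrix (Fin g) (Fin f) ℂ) (W : Matrix (Fin f) (Fin f) ℂ), W.IsHermitian →
      ∃ Δ : Matrix (Fin n) (Fin n) ℂ, (Δ.IsHermitian ∧ T * Δ * Tᴴ = G) ∧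
        inertia Δ = inertia (fromBlocks G Z Zᴴ W) := by
    intro Z W hW
    have hH := isHermitian_fromBlocks hG hW Z
    have hΔ : (U'ᴴ * fromBlocks G Z Zᴴ W * U').IsHermitian :=
      isHermitian_conjTranspose_mul_mul U' hH
    have h := hblock _ hΔ
    have e : Uᴴ * (U'ᴴ * fromBlocks G Z Zᴴ W * U') * U = fromBlocks G Z Zᴴ W := by
      calc _ = (U' * U)ᴴ * fromBlocks G Z Zᴴ W * (U' * U) := by
            simp only [conjTranspose_mul, Matrix.mul_assoc]
        _ = _ := by rw [hU', conjTranspose_one, Matrix.one_mul, Matrix.mul_one]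
    rw [e, fromBlocks_inj] at h
    exact ⟨_, ⟨hΔ, h.1.symm⟩, inertia_congr hH U' U hU'⟩
  have h1 : inertia (1 : Matrix (Fin f) (Fin f) ℂ) = ((f : ℤ), 0) := by
    have hp := iPos_eq_of_posDef (PosDef.one (n := Fin f) (R := ℂ))
    have hq := (posSemidef_iff_iNeg isHermitian_one).1 (PosSemidef.one (n := Fin f) (R := ℂ))
    rw [Fintype.card_fin] at hp
    exact Prod.ext hp hq
  refine ⟨f, hn, ?_, ?_, ?_, ?_, ?_⟩
  · intro Δ hΔ hTΔ
    rw [← inertia_congr hΔ U U' hU, hblock Δ hΔ, hTΔ]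
    have hW : (Fᴴ * Δ * F).IsHermitian := isHermitian_conjTranspose_mul_mul _ hΔ
    refine ⟨inertia_le_inertia_fromBlocks hG hW _, ?_⟩
    simpa using inertia_fromBlocks_le hG hW (T * Δ * F)
  · obtain ⟨Δ, hΔ, h⟩ := hex 0 0 isHermitian_zero
    refine ⟨Δ, hΔ, ?_⟩
    have h0 : inertia (0 : Matrix (Fin f) (Fin f) ℂ) = 0 :=
      Prod.ext ((neg_posSemidef_iff_iPos isHermitian_zero).1 (by rw [neg_zero]; exact .zero))
        ((posSemidef_iff_iNeg isHermitian_zero).1 .zero)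
    rw [h, conjTranspose_zero, inertia_fromBlocks_diag, h0, add_zero]
  · obtain ⟨Δ, hΔ, h⟩ := hex 0 1 isHermitian_one
    rw [conjTranspose_zero, inertia_fromBlocks_diag, h1] at h
    exact ⟨Δ, hΔ, congrArg Prod.fst h⟩
  · obtain ⟨Δ, hΔ, h⟩ := hex 0 (-1) isHermitian_one.neg
    rw [conjTranspose_zero, inertia_fromBlocks_diag, inertia_neg isHermitian_one, h1] at h
    exact ⟨Δ, hΔ, congrArg Prod.snd h⟩
  · obtain ⟨Z, W, hW, hr⟩ := exists_bordering_rk (f := f) hG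
    obtain ⟨Δ, hΔ, h⟩ := hex Z W hW
    refine ⟨Δ, hΔ, ?_⟩
    rw [rk_eq_iPos_add_iNeg (isHermitian_fromBlocks hG hW Z)] at hr
    have hp : iPos Δ = _ := congrArg Prod.fst h
    have hq : iNeg Δ = _ := congrArg Prod.snd h
    rw [rk_eq_iPos_add_iNeg hΔ.1, hp, hq]
    rwa [← hn, Nat.cast_add]

section

variable {m n : ℕ} {A : Matrix (Fin m) (Fin n) ℂ} {B : Matrix (Fin m) (Fin m) ℂ}

/-- The extrema over all `X - Y` in terms of the inertia `(p, q)` of the fixed compression, its size `g`,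
and the codimension `f`. -/
theorem exists_extrema (A : Matrix (Fin m) (Fin n) ℂ) (hB : B.IsHermitian) :
    ∃ g f ep en c p q : ℤ, g + f = n ∧ rk A = c + g ∧
      iPos (blockM A B) = rk A + ep ∧ iNeg (blockM A B) = rk A + en ∧
      iPos (blockN A B) = rk A + ep + c + q ∧ iNeg (blockN A B) = rk A + en + c + p ∧
      rk (fromCols A B) = rk A + ep + en + c ∧
      (B.PosSemidef → en = 0 ∧ c = 0 ∧ q = 0) ∧
      IsGreatest (values A B rk) (min (n : ℤ) (p + q + 2 * f)) ∧
      IsLeast (values A B rk) (p + q) ∧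
      IsGreatest (values A B iPos) (p + f) ∧ IsGreatest (values A B iNeg) (q + f) ∧
      IsLeast (values A B iPos) p ∧ IsLeast (values A B iNeg) q := by
  obtain ⟨g, T, T', G, ep, en, c, hT, hG, hA, hMp, hMn, hNp, hNn, hAB, hΔ, hpsd⟩ :=
    exists_compression A hB
  obtain ⟨f, hgf, hbd, ⟨Δ₀, hΔ₀, h₀⟩, ⟨Δ₁, hΔ₁, h₁⟩, ⟨Δ₂, hΔ₂, h₂⟩, ⟨Δ₃, hΔ₃, h₃⟩⟩ :=
    inertia_of_compression hT hG
  have hval : ∀ (φ : Matrix (Fin n) (Fin n) ℂ → ℤ) (v : ℤ), v ∈ values A B φ ↔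
      ∃ Δ, (Δ.IsHermitian ∧ T * Δ * Tᴴ = G) ∧ v = φ Δ := by
    intro φ v
    constructor
    · rintro ⟨X, hX, Y, hY, rfl⟩
      exact ⟨X - Y, (hΔ _).1 ⟨X, hX, Y, hY, rfl⟩, rfl⟩
    · rintro ⟨Δ, h, rfl⟩
      obtain ⟨X, hX, Y, hY, rfl⟩ := (hΔ Δ).2 h
      exact ⟨X, hX, Y, hY, rfl⟩
  have hb : ∀ Δ : Matrix (Fin n) (Fin n) ℂ, (Δ.IsHermitian ∧ T * Δ * Tᴴ = G) →
      iPos G ≤ iPos Δ ∧ iNeg G ≤ iNeg Δ ∧ iPos Δ ≤ iPos G + f ∧ iNeg Δ ≤ iNeg G + f ∧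
      rk Δ = iPos Δ + iNeg Δ ∧ rk Δ ≤ n := by
    intro Δ h
    obtain ⟨h1, h2⟩ := hbd Δ h.1 h.2
    have hr := rk_le_card Δ
    rw [Fintype.card_fin] at hr
    exact ⟨h1.1, h1.2, h2.1, h2.2, rk_eq_iPos_add_iNeg h.1, hr⟩
  have hp₀ : iPos Δ₀ = iPos G := congrArg Prod.fst h₀
  have hq₀ : iNeg Δ₀ = iNeg G := congrArg Prod.snd h₀
  have hrG := rk_eq_iPos_add_iNeg hG
  refine ⟨g, f, ep, en, c, iPos G, iNeg G, by exact_mod_cast hgf, hA, hMp, hMn, hNp, hNn, hAB,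
    hpsd, ⟨?_, ?_⟩, ⟨?_, ?_⟩, ⟨?_, ?_⟩, ⟨?_, ?_⟩, ⟨?_, ?_⟩, ⟨?_, ?_⟩⟩
  · have := hb Δ₃ hΔ₃
    exact (hval _ _).2 ⟨Δ₃, hΔ₃, by omega⟩
  · intro v hv
    obtain ⟨Δ, h, rfl⟩ := (hval _ _).1 hv
    have := hb Δ h
    omega
  · have := hb Δ₀ hΔ₀
    exact (hval _ _).2 ⟨Δ₀, hΔ₀, by omega⟩
  · intro v hv
    obtain ⟨Δ, h, rfl⟩ := (hval _ _).1 hv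
    have := hb Δ h
    omega
  · exact (hval _ _).2 ⟨Δ₁, hΔ₁, h₁.symm⟩
  · intro v hv
    obtain ⟨Δ, h, rfl⟩ := (hval _ _).1 hv
    exact (hb Δ h).2.2.1
  · exact (hval _ _).2 ⟨Δ₂, hΔ₂, h₂.symm⟩
  · intro v hv
    obtain ⟨Δ, h, rfl⟩ := (hval _ _).1 hv
    exact (hb Δ h).2.2.2.1
  · exact (hval _ _).2 ⟨Δ₀, hΔ₀, hp₀.symm⟩
  · intro v hv
    obtain ⟨Δ, h, rfl⟩ := (hval _ _).1 hv
    exact (hb Δ h).1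
  · exact (hval _ _).2 ⟨Δ₀, hΔ₀, hq₀.symm⟩
  · intro v hv
    obtain ⟨Δ, h, rfl⟩ := (hval _ _).1 hv
    exact (hb Δ h).2.1

/-- If `P X Y` says that `φ (X - Y)` equals a bound `k` for all values of `φ`, then some pair satisfies `P`
iff the extremum of `φ` on the side of `k` is `k`. -/
theorem exists_iff_of_extremum {φ : Matrix (Fin n) (Fin n) ℂ → ℤ}
    {P : Matrix (Fin n) (Fin n) ℂ → Matrix (Fin n) (Fin n) ℂ → Prop} {v k : ℤ}
    (hP : ∀ X Y : Matrix (Fin n) (Fin n) ℂ, (X - Y).IsHermitian → (P X Y ↔ φ (X - Y) = k))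
    (h : (IsGreatest (values A B φ) v ∧ ∀ Δ : Matrix (Fin n) (Fin n) ℂ, Δ.IsHermitian → φ Δ ≤ k) ∨
      (IsLeast (values A B φ) v ∧ ∀ Δ : Matrix (Fin n) (Fin n) ℂ, Δ.IsHermitian → k ≤ φ Δ)) :
    (∃ X ∈ leastSquares A B, ∃ Y ∈ leastRank A B, P X Y) ↔ v = k := by
  have e : (∃ X ∈ leastSquares A B, ∃ Y ∈ leastRank A B, P X Y) ↔ k ∈ values A B φ := by
    constructor
    · rintro ⟨X, hX, Y, hY, h⟩
      exact ⟨X, hX, Y, hY, ((hP X Y (hX.1.sub hY.1)).1 h).symm⟩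
    · rintro ⟨X, hX, Y, hY, h⟩
      exact ⟨X, hX, Y, hY, (hP X Y (hX.1.sub hY.1)).2 h.symm⟩
  rw [e]
  rcases h with ⟨hv, hk⟩ | ⟨hv, hk⟩ <;> obtain ⟨X, hX, Y, hY, hXY⟩ := hv.1
  · have := hk _ (hX.1.sub hY.1)
    exact ⟨fun h => le_antisymm (hXY ▸ this) (hv.2 h), fun h => h ▸ hv.1⟩
  · have := hk _ (hX.1.sub hY.1)
    exact ⟨fun h => le_antisymm (hv.2 h) (hXY ▸ this), fun h => h ▸ hv.1⟩

/-- If `P X Y` says that `φ (X - Y)` equals a bound `k` for all values of `φ`, then all pairs satisfy `P`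
iff the extremum of `φ` on the side away from `k` is `k`. -/
theorem forall_iff_of_extremum {φ : Matrix (Fin n) (Fin n) ℂ → ℤ}
    {P : Matrix (Fin n) (Fin n) ℂ → Matrix (Fin n) (Fin n) ℂ → Prop} {v k : ℤ}
    (hP : ∀ X Y : Matrix (Fin n) (Fin n) ℂ, (X - Y).IsHermitian → (P X Y ↔ φ (X - Y) = k))
    (h : (IsLeast (values A B φ) v ∧ ∀ Δ : Matrix (Fin n) (Fin n) ℂ, Δ.IsHermitian → φ Δ ≤ k) ∨
      (IsGreatest (values A B φ) v ∧ ∀ Δ : Matrix (Fin n) (Fin n) ℂ, Δ.IsHermitian → k ≤ φ Δ)) :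
    (∀ X ∈ leastSquares A B, ∀ Y ∈ leastRank A B, P X Y) ↔ v = k := by
  constructor
  · intro hall
    rcases h with ⟨hv, -⟩ | ⟨hv, -⟩ <;> obtain ⟨X, hX, Y, hY, hXY⟩ := hv.1 <;>
      rw [hXY] <;> exact (hP X Y (hX.1.sub hY.1)).1 (hall X hX Y hY)
  · rintro rfl X hX Y hY
    have hH := hX.1.sub hY.1
    rw [hP X Y hH]
    rcases h with ⟨hv, hk⟩ | ⟨hv, hk⟩
    · exact le_antisymm (hk _ hH) (hv.2 ⟨X, hX, Y, hY, rfl⟩)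
    · exact le_antisymm (hv.2 ⟨X, hX, Y, hY, rfl⟩) (hk _ hH)

theorem colSpace_le_iff_rk {l : ℕ} (C : Matrix (Fin m) (Fin l) ℂ) :
    colSpace C ≤ colSpace A ↔ rk (fromCols A C) = rk A := by
  obtain ⟨D⟩ := nonempty_rankFactorization A
  rw [D.rk_fromCols, D.rk_eq, add_eq_left, rk_eq_zero_iff]
  constructor
  · intro h
    ext i j
    obtain ⟨x, hx⟩ := h (LinearMap.mem_range_self C.mulVecLin (Pi.single j 1))
    have hx' : A *ᵥ x = C *ᵥ Pi.single j 1 := hx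
    have h1 : (D.Fᴴ * C) *ᵥ Pi.single j 1 = 0 := by
      rw [← mulVec_mulVec, ← hx', mulVec_mulVec, D.F_mul, zero_mulVec]
    simpa using congrFun h1 i
  · rintro h _ ⟨x, rfl⟩
    have e : C = A * (D.S * (D.Qᴴ * C)) := by
      rw [← Matrix.mul_assoc, D.mul_S]
      calc C = (D.Q * D.Qᴴ + D.F * D.Fᴴ) * C := by rw [D.compl, Matrix.one_mul]
        _ = _ := by rw [Matrix.add_mul, Matrix.mul_assoc D.F, h, Matrix.mul_zero, add_zero,
          Matrix.mul_assoc]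
    refine ⟨(D.S * (D.Qᴴ * C)) *ᵥ x, ?_⟩
    rw [mulVecLin_apply, mulVecLin_apply, mulVec_mulVec, ← e]

theorem isHermitian_blockM (hB : B.IsHermitian) : (blockM A B).IsHermitian :=
  isHermitian_fromBlocks hB isHermitian_zero A

theorem isHermitian_blockN (hB : B.IsHermitian) : (blockN A B).IsHermitian := by
  have h := isHermitian_fromBlocks hB (isHermitian_zero (n := Fin n ⊕ Fin n)) (fromCols (B * A) A)
  rwa [conjTranspose_fromCols_eq_fromRows_conjTranspose, conjTranspose_mul, hB.eq] at h

end

end HermSol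

theorem theorem6p2 {m n : ℕ} (A : Matrix (Fin m) (Fin n) ℂ) (B : Matrix (Fin m) (Fin m) ℂ)
    (hB : B.IsHermitian) :
    -- extremal ranks and inertias
    IsGreatest (values A B rk) (min (n : ℤ) (2 * n + rk (blockN A B) - 2 * rk A - rk (blockM A B))) ∧
    IsLeast (values A B rk) (rk (blockN A B) + rk (blockM A B) - 2 * rk (Matrix.fromCols A B) - 2 * rk A) ∧
    IsGreatest (values A B iPos) (iNeg (blockN A B) + n - rk A - iNeg (blockM A B)) ∧
    IsGreatest (values A B iNeg) (iPos (blockN A B) + n - rk A - iPos (blockM A B)) ∧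
    IsLeast (values A B iPos) (iNeg (blockN A B) + iPos (blockM A B) - rk (Matrix.fromCols A B) - rk A) ∧
    IsLeast (values A B iNeg) (iPos (blockN A B) + iNeg (blockM A B) - rk (Matrix.fromCols A B) - rk A) ∧
    -- nonsingularity, equality, Loewner inequalities
    ((∃ X ∈ leastSquares A B, ∃ Y ∈ leastRank A B, IsUnit (X - Y)) ↔
        rk (blockN A B) ≥ 2 * rk A + rk (blockM A B) - n) ∧
    ((∀ X ∈ leastSquares A B, ∀ Y ∈ leastRank A B, IsUnit (X - Y)) ↔
        rk (blockN A B) + rk (blockM A B) = 2 * rk (Matrix.fromCols A B) + 2 * rk A + n) ∧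
    ((∃ X ∈ leastSquares A B, ∃ Y ∈ leastRank A B, X = Y) ↔
        rk (blockN A B) + rk (blockM A B) = 2 * rk (Matrix.fromCols A B) + 2 * rk A) ∧
    ((∃ X ∈ leastSquares A B, ∃ Y ∈ leastRank A B, (X - Y).PosDef) ↔
        iNeg (blockN A B) = iNeg (blockM A B) + rk A) ∧
    ((∀ X ∈ leastSquares A B, ∀ Y ∈ leastRank A B, (X - Y).PosDef) ↔
        iNeg (blockN A B) = rk A + rk (Matrix.fromCols A B) - iPos (blockM A B) + n) ∧
    ((∃ X ∈ leastSquares A B, ∃ Y ∈ leastRank A B, (X - Y).PosSemidef) ↔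
        iPos (blockN A B) = rk A + rk (Matrix.fromCols A B) - iNeg (blockM A B)) ∧
    ((∀ X ∈ leastSquares A B, ∀ Y ∈ leastRank A B, (X - Y).PosSemidef) ↔
        iPos (blockN A B) = iPos (blockM A B) + rk A - n) ∧
    ((∃ X ∈ leastSquares A B, ∃ Y ∈ leastRank A B, (Y - X).PosDef) ↔
        iPos (blockN A B) = iPos (blockM A B) + rk A) ∧
    ((∀ X ∈ leastSquares A B, ∀ Y ∈ leastRank A B, (Y - X).PosDef) ↔
        iPos (blockN A B) = rk A + rk (Matrix.fromCols A B) - iNeg (blockM A B) + n) ∧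
    ((∃ X ∈ leastSquares A B, ∃ Y ∈ leastRank A B, (Y - X).PosSemidef) ↔
        iNeg (blockN A B) = rk A + rk (Matrix.fromCols A B) - iPos (blockM A B)) ∧
    ((∀ X ∈ leastSquares A B, ∀ Y ∈ leastRank A B, (Y - X).PosSemidef) ↔
        iNeg (blockN A B) = iNeg (blockM A B) + rk A - n) ∧
    -- the positive semidefinite case
    (B.PosSemidef →
      (IsGreatest (values A B rk) (min (n : ℤ) (2 * n + rk (Matrix.fromCols A (B * A)) - 3 * rk A))) ∧
      (IsLeast (values A B rk) (rk (Matrix.fromCols A (B * A)) - rk A)) ∧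
      (IsGreatest (values A B iPos) (rk (Matrix.fromCols A (B * A)) + n - 2 * rk A)) ∧
      (IsGreatest (values A B iNeg) (n - rk A)) ∧
      (IsLeast (values A B iPos) (rk (Matrix.fromCols A (B * A)) - rk A)) ∧
      (IsLeast (values A B iNeg) (0)) ∧
      ((∃ X ∈ leastSquares A B, ∃ Y ∈ leastRank A B, IsUnit (X - Y)) ↔
        rk (Matrix.fromCols A (B * A)) ≥ 3 * rk A - n) ∧
      ((∀ X ∈ leastSquares A B, ∀ Y ∈ leastRank A B, IsUnit (X - Y)) ↔
        rk (Matrix.fromCols A (B * A)) = rk A + n) ∧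
      ((∃ X ∈ leastSquares A B, ∃ Y ∈ leastRank A B, X = Y) ↔
        colSpace (B * A) ≤ colSpace A) ∧
      ((∃ X ∈ leastSquares A B, ∃ Y ∈ leastRank A B, (X - Y).PosDef) ↔
        rk (Matrix.fromCols A (B * A)) = 2 * rk A) ∧
      ((∀ X ∈ leastSquares A B, ∀ Y ∈ leastRank A B, (X - Y).PosDef) ↔
        rk (Matrix.fromCols A (B * A)) = rk A + n) ∧
      ((∃ X ∈ leastSquares A B, ∃ Y ∈ leastRank A B, (X - Y).PosSemidef)) ∧
      ((∀ X ∈ leastSquares A B, ∀ Y ∈ leastRank A B, (X - Y).PosSemidef) ↔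
        rk A = n) ∧
      ((∃ X ∈ leastSquares A B, ∃ Y ∈ leastRank A B, (Y - X).PosDef) ↔
        A = 0) ∧
      ((∃ X ∈ leastSquares A B, ∃ Y ∈ leastRank A B, (Y - X).PosSemidef) ↔
        colSpace (B * A) ≤ colSpace A) ∧
      ((∀ X ∈ leastSquares A B, ∀ Y ∈ leastRank A B, (Y - X).PosSemidef) ↔
        rk (Matrix.fromCols A (B * A)) = 2 * rk A - n)) := by
  obtain ⟨g, f, ep, en, c, p, q, hgf, hA, hMp, hMn, hNp, hNn, hAB, hpsd, hrmax, hrmin, hpmax, hqmax,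
    hpmin, hqmin⟩ := exists_extrema A hB
  have hM := rk_eq_iPos_add_iNeg (isHermitian_blockM (A := A) hB)
  have hN := rk_eq_iPos_add_iNeg (isHermitian_blockN (A := A) hB)
  -- the Loewner and rank conditions as extreme values of `r`, `i₊` and `i₋`
  have hr : ∀ Δ : Matrix (Fin n) (Fin n) ℂ, Δ.IsHermitian → rk Δ ≤ n := fun Δ _ => by
    simpa using rk_le_card Δ
  have hr0 : ∀ Δ : Matrix (Fin n) (Fin n) ℂ, Δ.IsHermitian → 0 ≤ rk Δ := fun Δ _ => rk_nonneg Δ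
  have hp : ∀ Δ : Matrix (Fin n) (Fin n) ℂ, Δ.IsHermitian → iPos Δ ≤ n := fun Δ h => by
    have := hr Δ h
    have := rk_eq_iPos_add_iNeg h
    have := iNeg_nonneg Δ
    omega
  have hq : ∀ Δ : Matrix (Fin n) (Fin n) ℂ, Δ.IsHermitian → iNeg Δ ≤ n := fun Δ h => by
    have := hr Δ h
    have := rk_eq_iPos_add_iNeg h
    have := iPos_nonneg Δ
    omega
  have hp0 : ∀ Δ : Matrix (Fin n) (Fin n) ℂ, Δ.IsHermitian → 0 ≤ iPos Δ := fun Δ _ => iPos_nonneg Δ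
  have hq0 : ∀ Δ : Matrix (Fin n) (Fin n) ℂ, Δ.IsHermitian → 0 ≤ iNeg Δ := fun Δ _ => iNeg_nonneg Δ
  have unit : ∀ X Y : Matrix (Fin n) (Fin n) ℂ, (X - Y).IsHermitian →
      (IsUnit (X - Y) ↔ rk (X - Y) = n) := fun X Y _ => by
    rw [isUnit_iff_rk, Fintype.card_fin]
  have eq : ∀ X Y : Matrix (Fin n) (Fin n) ℂ, (X - Y).IsHermitian →
      (X = Y ↔ rk (X - Y) = 0) := fun X Y _ => by
    rw [rk_eq_zero_iff, sub_eq_zero]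
  have pd : ∀ X Y : Matrix (Fin n) (Fin n) ℂ, (X - Y).IsHermitian →
      ((X - Y).PosDef ↔ iPos (X - Y) = n) := fun X Y h => by
    rw [posDef_iff_iPos h, Fintype.card_fin]
  have psd : ∀ X Y : Matrix (Fin n) (Fin n) ℂ, (X - Y).IsHermitian →
      ((X - Y).PosSemidef ↔ iNeg (X - Y) = 0) := fun X Y h => posSemidef_iff_iNeg h
  have nd : ∀ X Y : Matrix (Fin n) (Fin n) ℂ, (X - Y).IsHermitian →
      ((Y - X).PosDef ↔ iNeg (X - Y) = n) := fun X Y h => by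
    rw [← neg_sub X Y, neg_posDef_iff_iNeg h, Fintype.card_fin]
  have nsd : ∀ X Y : Matrix (Fin n) (Fin n) ℂ, (X - Y).IsHermitian →
      ((Y - X).PosSemidef ↔ iPos (X - Y) = 0) := fun X Y h => by
    rw [← neg_sub X Y, neg_posSemidef_iff_iPos h]
  have a₁ := exists_iff_of_extremum unit (.inl ⟨hrmax, hr⟩)
  have a₂ := forall_iff_of_extremum unit (.inl ⟨hrmin, hr⟩)
  have a₃ := exists_iff_of_extremum eq (.inr ⟨hrmin, hr0⟩)
  have a₄ := exists_iff_of_extremum pd (.inl ⟨hpmax, hp⟩)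
  have a₅ := forall_iff_of_extremum pd (.inl ⟨hpmin, hp⟩)
  have a₆ := exists_iff_of_extremum psd (.inr ⟨hqmin, hq0⟩)
  have a₇ := forall_iff_of_extremum psd (.inr ⟨hqmax, hq0⟩)
  have a₈ := exists_iff_of_extremum nd (.inl ⟨hqmax, hq⟩)
  have a₉ := forall_iff_of_extremum nd (.inl ⟨hqmin, hq⟩)
  have a₁₀ := exists_iff_of_extremum nsd (.inr ⟨hpmin, hp0⟩)
  have a₁₁ := forall_iff_of_extremum nsd (.inr ⟨hpmax, hp0⟩)
  rw [a₁, a₂, a₃, a₄, a₅, a₆, a₇, a₈, a₉, a₁₀, a₁₁]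
  refine ⟨?_, ?_, ?_, ?_, ?_, ?_, by omega, by omega, by omega, by omega, by omega, by omega,
    by omega, by omega, by omega, by omega, by omega, fun hB' => ?_⟩
  · convert hrmax using 1; omega
  · convert hrmin using 1; omega
  · convert hpmax using 1; omega
  · convert hqmax using 1; omega
  · convert hpmin using 1; omega
  · convert hqmin using 1; omega
  -- `r[A, BA] = i₋(N) = r(A) + i₊(G)` for positive semidefinite `B`
  · obtain ⟨hen, hc, hq'⟩ := hpsd hB'
    have hK := iNeg_blockN_of_posSemidef (A := A) hB'
    have hA0 : A = 0 ↔ rk A = 0 := rk_eq_zero_iff.symm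
    have hcol := colSpace_le_iff_rk (A := A) (B * A)
    rw [hcol, hA0]
    refine ⟨?_, ?_, ?_, ?_, ?_, ?_, by omega, by omega, by omega, by omega, by omega, hq', by omega,
      by omega, by omega, by omega⟩
    · convert hrmax using 1; omega
    · convert hrmin using 1; omega
    · convert hpmax using 1; omega
    · convert hqmax using 1; omega
    · convert hpmin using 1; omega
    · convert hqmin using 1; omega
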